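/- **Theorem 1.3.** For $n\ge 0$ let $B_n$ be the set of signed permutations of order $n$, that is, of words $w=x_1x_2\cdots x_n$ with $x_i\in\{-n,\ldots,-1,1,\ldots,n\}$ such that $|x_1||x_2|\cdots|x_n|$ is a permutation of $12\cdots n$. For $w\in B_n$ let $\operatorname{neg} w$ be the number of $i$ with $x_i<0$, let $\operatorname{fix}^+w$ (resp. $\operatorname{fix}^-w$) be the number of $i$ with $x_i=i$ (resp. $x_i=-i$), and, with $\chi(A)=1$ or $0$ according to whether the statement $A$ is true or not, let $$\operatorname{des}w=\sum_{i=1}^{n-1}\chi(x_i>x_{i+1}),\quad \operatorname{maj}w=\sum_{i=1}^{n-1} i\,\chi(x_i>x_{i+1}),\quad \operatorname{fdes}w=2\operatorname{des}w+\chi(x_1<0),\quad \operatorname{fmaj}w=2\operatorname{maj}w+\operatorname{neg}w$$ (for the empty word all these numbers are $0$). Write $(a;q)_n=\prod_{i=0}^{n-1}(1-aq^i)$ and $(a;q)_\infty=\prod_{i\ge0}(1-aq^i)$. All identities below are between formal power series with rational coefficients in the indeterminates involved. (a) There is a unique sequence of polynomials $B_n(t,q,Y_0,Y_1,Z)$ $(n\ge0)$,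 with rational coefficients, such that $$\sum_{n\ge 0}(1+t)B_n(t,q,Y_0,Y_1,Z)\frac{u^n}{(t^2;q^2)_{n+1}}=\sum_{s\ge 0} t^s\Bigl(1-u\sum_{i=0}^s q^iZ^{\chi(i\text{ odd})}\Bigr)^{-1}\frac{(u;q^2)_{\lfloor s/2\rfloor+1}}{(uY_0;q^2)_{\lfloor s/2\rfloor+1}}\,\frac{(-uqY_1Z;q^2)_{\lfloor (s+1)/2\rfloor}}{(-uqZ;q^2)_{\lfloor (s+1)/2\rfloor}},$$ and for every $n\ge 0$ $$B_n(t,q,Y_0,Y_1,Z)=\sum_{w\in B_n}t^{\operatorname{fdes}w}q^{\operatorname{fmaj}w}Y_0^{\operatorname{fix}^+w}Y_1^{\operatorname{fix}^-w}Z^{\operatorname{neg}w}.$$ (b) There is a unique sequence of polynomials $B_n(q,Y_0,Y_1,Z)$ $(n\ge 0)$, with rational coefficients, such that $$\sum_{n\ge 0}\frac{u^n}{(q^2;q^2)_n}B_n(q,Y_0,Y_1,Z)=\Bigl(1-u\,\frac{1+qZ}{1-q^2}\Bigr)^{-1}\frac{(u;q^2)_\infty}{(uY_0;q^2)_\infty}\,\frac{(-uqY_1Z;q^2)_\infty}{(-uqZ;q^2)_\infty},$$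 and for every $n\ge0$ $$B_n(1,q,Y_0,Y_1,Z)=B_n(q,Y_0,Y_1,Z)=\sum_{w\in B_n}q^{\operatorname{fmaj}w}Y_0^{\operatorname{fix}^+w}Y_1^{\operatorname{fix}^-w}Z^{\operatorname{neg}w}.$$ -/

import Mathlib

namespace SignedWords

open scoped MvPowerSeries.WithPiTopology

/-! ### Signed permutations and their statistics -/

/-- The hyperoctahedral group `B_n`, as the set of words `x_1 x_2 ⋯ x_n` with letters in
`{-n, …, n}` such that `|x_1|, …, |x_n|` is a permutation of `1, …, n`.
The letter `x_{i+1}` is `x i` for `i : Fin n`. -/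
noncomputable def signedPerms (n : ℕ) : Finset (Fin n → ℤ) :=
  (Fintype.piFinset fun _ : Fin n => Finset.Icc (-(n : ℤ)) (n : ℤ)).filter fun x =>
    Finset.univ.image (fun i => (x i).natAbs) = Finset.Icc 1 n

/-- The positions `i` (numbered from `0`) with `i + 1 < n` where the word descends, that is,
`x_{i+1} > x_{i+2}` with letters numbered from `1`. -/
def descents {n : ℕ} (x : Fin n → ℤ) : Finset (Fin n) :=
  Finset.univ.filter fun i => ∃ h : (i : ℕ) + 1 < n, x ⟨(i : ℕ) + 1, h⟩ < x i

/-- Number of descents. -/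
def des {n : ℕ} (x : Fin n → ℤ) : ℕ := (descents x).card

/-- Major index: the sum of the descent positions, numbered from `1`. -/
def maj {n : ℕ} (x : Fin n → ℤ) : ℕ := ∑ i ∈ descents x, ((i : ℕ) + 1)

/-- Number of negative letters. -/
def neg {n : ℕ} (x : Fin n → ℤ) : ℕ := (Finset.univ.filter fun i => x i < 0).card

/-- Number of positive fixed points, `x_i = i` with letters numbered from `1`. -/
def fixPos {n : ℕ} (x : Fin n → ℤ) : ℕ :=
  (Finset.univ.filter fun i : Fin n => x i = ((i : ℕ) : ℤ) + 1).card

/-- Number of negative fixed points, `x_i = -i` with letters numbered from `1`. -/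
def fixNeg {n : ℕ} (x : Fin n → ℤ) : ℕ :=
  (Finset.univ.filter fun i : Fin n => x i = -(((i : ℕ) : ℤ) + 1)).card

/-- Flag descent number, `2 des + χ(x_1 < 0)`; it is `0` for the empty word. -/
def fdes {n : ℕ} (x : Fin n → ℤ) : ℕ :=
  2 * des x + if ∃ h : 0 < n, x ⟨0, h⟩ < 0 then 1 else 0

/-- Flag-major index, `2 maj + neg`. -/
def fmaj {n : ℕ} (x : Fin n → ℤ) : ℕ := 2 * maj x + neg x

/-! ### Polynomials and formal power series -/

/-- The six indeterminates. -/
inductive Var : Type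
  | t | u | q | Y₀ | Y₁ | Z

/-- Polynomials over `ℚ` in the six indeterminates. -/
abbrev Poly : Type := MvPolynomial Var ℚ

/-- Formal power series over `ℚ` in the six indeterminates. Infinite sums and products of series
are taken for coefficientwise convergence, and `f⁻¹` is the inverse of a series whose constant
term is not zero (every series inverted below has constant term `1`). -/
abbrev Series : Type := MvPowerSeries Var ℚ

/-- An indeterminate as a polynomial. -/
noncomputable abbrev pX (i : Var) : Poly := MvPolynomial.X i

/-- An indeterminate as a formal power series. -/
noncomputable abbrev sX (i : Var) : Series := MvPowerSeries.X i

/-- The finite `q`-ascending factorial `(a; p)_n = (1 - a)(1 - a p) ⋯ (1 - a p^(n-1))`. -/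
noncomputable def poch (a p : Series) (n : ℕ) : Series :=
  ∏ i ∈ Finset.range n, (1 - a * p ^ i)

/-- The infinite `q`-ascending factorial `(a; p)_∞`. -/
noncomputable def pochInf (a p : Series) : Series :=
  ∏' i : ℕ, (1 - a * p ^ i)

/-- The coefficient of `t ^ s` on the right-hand side of the identity that defines the
polynomials `B_n(t, q, Y₀, Y₁, Z)`. -/
noncomputable def gradedTerm (s : ℕ) : Series :=
  (1 - sX .u * ∑ i ∈ Finset.range (s + 1), sX .q ^ i * sX .Z ^ (if Odd i then 1 else 0))⁻¹
    * (poch (sX .u) (sX .q ^ 2) (s / 2 + 1) * (poch (sX .u * sX .Y₀) (sX .q ^ 2) (s / 2 + 1))⁻¹)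
    * (poch (-(sX .u * sX .q * sX .Y₁ * sX .Z)) (sX .q ^ 2) ((s + 1) / 2)
      * (poch (-(sX .u * sX .q * sX .Z)) (sX .q ^ 2) ((s + 1) / 2))⁻¹)

/-- `B` is a sequence of polynomials in `t, q, Y₀, Y₁, Z` that satisfies
`∑_n (1 + t) B_n u^n / (t²; q²)_{n+1} = ∑_s t^s (gradedTerm s)`: both series converge and
their sums agree. -/
def IsGradedSeq (B : ℕ → Poly) : Prop :=
  (∀ n, B n ∈ MvPolynomial.supported ℚ {Var.t, Var.q, Var.Y₀, Var.Y₁, Var.Z}) ∧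
  ∃ F : Series,
    HasSum (fun n : ℕ => (1 + sX .t) * (B n : Series) *
      (sX .u ^ n * (poch (sX .t ^ 2) (sX .q ^ 2) (n + 1))⁻¹)) F ∧
    HasSum (fun s : ℕ => sX .t ^ s * gradedTerm s) F

/-- `C` is a sequence of polynomials in `q, Y₀, Y₁, Z` that satisfies
`∑_n C_n u^n / (q²; q²)_n = (1 - u (1 + q Z) / (1 - q²))⁻¹
  (u; q²)_∞ / (u Y₀; q²)_∞ · (-u q Y₁ Z; q²)_∞ / (-u q Z; q²)_∞`. -/
def IsFmajSeq (C : ℕ → Poly) : Prop :=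
  (∀ n, C n ∈ MvPolynomial.supported ℚ {Var.q, Var.Y₀, Var.Y₁, Var.Z}) ∧
  HasSum (fun n : ℕ => sX .u ^ n * (poch (sX .q ^ 2) (sX .q ^ 2) n)⁻¹ * (C n : Series))
    ((1 - sX .u * ((1 + sX .q * sX .Z) * (1 - sX .q ^ 2)⁻¹))⁻¹
      * (pochInf (sX .u) (sX .q ^ 2) * (pochInf (sX .u * sX .Y₀) (sX .q ^ 2))⁻¹)
      * (pochInf (-(sX .u * sX .q * sX .Y₁ * sX .Z)) (sX .q ^ 2)
        * (pochInf (-(sX .u * sX .q * sX .Z)) (sX .q ^ 2))⁻¹))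

/-- The substitution `t = 1` in a polynomial. -/
noncomputable def setTOne : Poly →ₐ[ℚ] Poly :=
  MvPolynomial.aeval fun i => match i with
    | .t => 1
    | i => pX i

end SignedWords

open SignedWords

/-! Both sides count words `c` of length `n` over the letters `0, …, s`, where a letter `a` weighs
`q^a`, times `Z` if `a` is odd, and a letter that keeps its place under sorting weighs an extra `Y₀`
(even) or `Y₁` (odd).

Sorting `c` gives a pair `(w, b)`: `w` lists the positions in sorted order, with a minus sign at odd
letters, and `b` is the sorted word. This is a bijection onto the compatible pairs, and fixed
positions of `c` become signed fixed points of `w` (`wordSum_eq_sum_signedPerms`). For fixed `w`,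
the compatible `b` are a minimal word plus twice a partition (`compatible_iff`). The minimal word
has sum `fmaj w` and first letter `fdes w`, so the bound `b ≤ s` yields a Gaussian binomial in `q²`.
Summation against `t^s` then gives `(1 + t) t^fdes q^fmaj / (t²; q²)_{n+1}`.

For fixed `s`, the generating series in `u` is computed one letter at a time. Words with a fixed
letter `a` arise uniquely by inserting a fixed `a` into an arbitrary word if `a` is even, and into a
word without fixed `a` if `a` is odd (`sum_not_noFixed`). Comparing `Y a` with `1` therefore costs
the factor `(1 - u x) / (1 - u x Y)` or `(1 + u x Y) / (1 + u x)`. With all `Y a = 1` the series is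
geometric (`uSeries_wordSum`).

Part (b) is the limit `s → ∞` of the same identity. Uniqueness is comparison of coefficients in `u`.
-/

namespace SignedWords

open Finset Filter Topology
open scoped MvPowerSeries.WithPiTopology

/-! ### Fixed positions of a word under signed standardization -/

section Rank

variable {n : ℕ}

/-- Position `j` comes before position `k` when the letters of `c` are sorted in decreasing
order, equal even letters being read from left to right and equal odd letters from right to
left. -/
def Precedes (c : Fin n → ℕ) (j k : Fin n) : Prop :=
  c k < c j ∨ (c j = c k ∧ if Even (c k) then j < k else k < j)

instance (c : Fin n → ℕ) (j k : Fin n) : Decidable (Precedes c j k) := by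
  unfold Precedes; infer_instance

/-- The number of positions sorted before position `k`. -/
def rank (c : Fin n → ℕ) (k : Fin n) : ℕ := #{j | Precedes c j k}

/-- Position `k` keeps its place when the letters of `c` are sorted. -/
def IsFixed (c : Fin n → ℕ) (k : Fin n) : Prop := rank c k = k

instance (c : Fin n → ℕ) (k : Fin n) : Decidable (IsFixed c k) := by
  unfold IsFixed; infer_instance

lemma Precedes.trans {c : Fin n → ℕ} {i j k : Fin n} (h₁ : Precedes c i j)
    (h₂ : Precedes c j k) : Precedes c i k := by
  unfold Precedes at *
  rcases h₁ with h₁ | ⟨e₁, h₁⟩ <;> rcases h₂ with h₂ | ⟨e₂, h₂⟩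
  · exact Or.inl (h₂.trans h₁)
  · exact Or.inl (e₂ ▸ h₁)
  · exact Or.inl (e₁ ▸ h₂)
  · refine Or.inr ⟨e₁.trans e₂, ?_⟩
    rw [← e₂] at h₂ ⊢
    split_ifs at * <;> omega

lemma not_precedes_self (c : Fin n → ℕ) (k : Fin n) : ¬ Precedes c k k := by
  simp [Precedes]

lemma precedes_or_precedes (c : Fin n → ℕ) {j k : Fin n} (h : j ≠ k) :
    Precedes c j k ∨ Precedes c k j := by
  unfold Precedes
  rcases lt_trichotomy (c j) (c k) with h' | h' | h'
  · exact Or.inr (Or.inl h')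
  · rw [h']
    rcases lt_or_gt_of_ne h with h | h <;> by_cases he : Even (c k) <;> simp [he, h]
  · exact Or.inl (Or.inl h')

lemma Precedes.rank_lt {c : Fin n → ℕ} {j k : Fin n} (h : Precedes c j k) :
    rank c j < rank c k := by
  refine card_lt_card ⟨fun i hi => ?_, fun hs => ?_⟩
  · simp only [mem_filter, mem_univ, true_and] at hi ⊢
    exact hi.trans h
  · have := hs (by simpa using h)
    exact not_precedes_self c j (by simpa using this)

lemma precedes_insertNth_succAbove (c : Fin n → ℕ) (a : ℕ) (k : Fin (n + 1)) (i j : Fin n) :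
    Precedes (k.insertNth (α := fun _ => ℕ) a c) (k.succAbove i) (k.succAbove j) ↔
      Precedes c i j := by
  simp [Precedes]

lemma rank_insertNth_succAbove (c : Fin n → ℕ) (a : ℕ) (k : Fin (n + 1)) (i : Fin n) :
    rank (k.insertNth (α := fun _ => ℕ) a c) (k.succAbove i) =
      (if Precedes (k.insertNth (α := fun _ => ℕ) a c) k (k.succAbove i) then 1 else 0) +
        rank c i := by
  simp only [rank, card_filter, Fin.sum_univ_succAbove _ k, precedes_insertNth_succAbove]

/-- The inserted letter has rank and position `k`. Another letter whose rank and position lie on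
opposite sides of `k` is fixed neither before nor after the insertion; on a common side, both
numbers shift together. -/
lemma isFixed_insertNth_succAbove {c : Fin n → ℕ} {a : ℕ} {k : Fin (n + 1)}
    (h : IsFixed (k.insertNth (α := fun _ => ℕ) a c) k) (i : Fin n) :
    IsFixed (k.insertNth (α := fun _ => ℕ) a c) (k.succAbove i) ↔ IsFixed c i := by
  have hr := rank_insertNth_succAbove c a k i
  unfold IsFixed at *
  have hv : (k.succAbove i : ℕ) = if (i : ℕ) < k then (i : ℕ) else i + 1 := by
    simp only [Fin.succAbove, Fin.lt_def, Fin.val_castSucc]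
    split_ifs <;> simp
  rw [hv]
  by_cases hp : Precedes (k.insertNth (α := fun _ => ℕ) a c) k (k.succAbove i)
  · have := hp.rank_lt
    rw [if_pos hp] at hr
    split_ifs <;> omega
  · have := ((precedes_or_precedes _ (Fin.succAbove_ne k i)).resolve_right hp).rank_lt
    rw [if_neg hp] at hr
    split_ifs <;> omega

/-- The rank that a letter `a` inserted into `c` with `k` letters on its left receives. -/
def slot (c : Fin n → ℕ) (a k : ℕ) : ℕ :=
  #{j : Fin n | a < c j ∨ (c j = a ∧ if Even a then (j : ℕ) < k else k ≤ j)}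

lemma rank_insertNth_self (c : Fin n → ℕ) (a : ℕ) (k : Fin (n + 1)) :
    rank (k.insertNth (α := fun _ => ℕ) a c) k = slot c a k := by
  simp only [rank, slot, card_filter, Fin.sum_univ_succAbove _ k, not_precedes_self, if_false,
    zero_add]
  refine sum_congr rfl fun j _ => if_congr ?_ rfl rfl
  simp only [Precedes, Fin.insertNth_apply_same, Fin.insertNth_apply_succAbove,
    Fin.succAbove_lt_iff_castSucc_lt, Fin.lt_succAbove_iff_le_castSucc]
  simp [Fin.lt_def, Fin.le_def]

lemma slot_le (c : Fin n → ℕ) (a k : ℕ) : slot c a k ≤ n :=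
  (card_le_univ _).trans (by simp)

/-- For even `a` the slot grows by `0` or `1` per step to the right; for odd `a` it falls by `0` or
`1`. The whole difference between the two parities comes from this. -/
lemma slot_succ_of_even (c : Fin n → ℕ) {a : ℕ} (ha : Even a) (k : Fin n) :
    slot c a (k + 1) = slot c a k + if c k = a then 1 else 0 := by
  have : (if c k = a then 1 else 0 : ℕ) = ∑ j, if j = k then (if c k = a then 1 else 0) else 0 := by
    simp
  rw [this]
  simp only [slot, card_filter, ha, if_true, ← sum_add_distrib]
  refine sum_congr rfl fun j _ => ?_
  rcases lt_trichotomy j k with h | h | h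
  · have h' : (j : ℕ) < k := h
    simp [h.ne, h', h'.trans (Nat.lt_succ_self _)]
  · subst h
    by_cases h : c j = a <;> simp [h]
  · have h' : (k : ℕ) < j := h
    simp [h.ne', h'.not_gt, show ¬ (j : ℕ) < k + 1 by omega]

lemma slot_succ_of_not_even (c : Fin n → ℕ) {a : ℕ} (ha : ¬ Even a) (k : Fin n) :
    slot c a k = slot c a (k + 1) + if c k = a then 1 else 0 := by
  have : (if c k = a then 1 else 0 : ℕ) = ∑ j, if j = k then (if c k = a then 1 else 0) else 0 := by
    simp
  rw [this]
  simp only [slot, card_filter, ha, if_false, ← sum_add_distrib]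
  refine sum_congr rfl fun j _ => ?_
  rcases lt_trichotomy j k with h | h | h
  · have h' : (j : ℕ) < k := h
    simp [h.ne, h'.not_ge, show ¬ ((k : ℕ) + 1 ≤ j) by omega]
  · subst h
    by_cases h : c j = a <;> simp [h]
  · have h' : (k : ℕ) < j := h
    simp [h.ne', h'.le, show ((k : ℕ) + 1 ≤ j) by omega]

lemma rank_eq_slot_of_even (c : Fin n → ℕ) (k : Fin n) (h : Even (c k)) :
    rank c k = slot c (c k) k := by
  simp [rank, slot, Precedes, h]

lemma rank_eq_slot_of_not_even (c : Fin n → ℕ) (k : Fin n) (h : ¬ Even (c k)) :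
    rank c k = slot c (c k) (k + 1) := by
  simp [rank, slot, Precedes, h]

lemma slot_le_slot_add (c : Fin n → ℕ) {a : ℕ} (ha : Even a) {i k : ℕ} (hik : i ≤ k)
    (hk : k ≤ n) : slot c a k ≤ slot c a i + (k - i) := by
  induction k, hik using Nat.le_induction with
  | base => simp
  | succ k hik ih =>
    have := slot_succ_of_even c ha ⟨k, hk⟩
    have := ih (by omega)
    simp only at *
    split_ifs at * <;> omega

lemma slot_antitone_of_not_even (c : Fin n → ℕ) {a : ℕ} (ha : ¬ Even a) : Antitone (slot c a) := by
  intro i k hik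
  refine card_le_card fun j hj => ?_
  simp only [mem_filter, mem_univ, true_and, ha, if_false] at hj ⊢
  exact hj.imp_right fun h => ⟨h.1, hik.trans h.2⟩

/-- No occurrence of the letter `a` in `c` is a fixed position. -/
def NoFixed (c : Fin n → ℕ) (a : ℕ) : Prop := ∀ k, c k = a → ¬ IsFixed c k

instance (c : Fin n → ℕ) (a : ℕ) : Decidable (NoFixed c a) := by
  unfold NoFixed; infer_instance

lemma exists_slot_le (c : Fin n → ℕ) (a : ℕ) : ∃ k, slot c a k ≤ k := ⟨n, slot_le c a n⟩

/-- The leftmost place at which a letter `a` can be inserted into `c` as a fixed position. -/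
def insertPos (c : Fin n → ℕ) (a : ℕ) : Fin (n + 1) :=
  ⟨Nat.find (exists_slot_le c a), Nat.lt_succ_of_le (Nat.find_min' _ (slot_le c a n))⟩

lemma lt_slot_of_lt_insertPos {c : Fin n → ℕ} {a k : ℕ} (h : k < insertPos c a) :
    k < slot c a k := by
  simpa using Nat.find_min (exists_slot_le c a) h

lemma insertPos_eq {c : Fin n → ℕ} {a : ℕ} {k : Fin (n + 1)} (h : slot c a k ≤ k)
    (hlt : ∀ i : ℕ, i < k → i < slot c a i) : insertPos c a = k := by
  refine Fin.ext ((Nat.find_eq_iff _).2 ⟨h, fun i hi => (hlt i hi).not_ge⟩)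

/-- At the first `k` with `slot c a k ≤ k` equality has to hold. For even `a` the difference `k -
slot c a k` never rises by more than `1`, so it cannot jump over `0`. For odd `a` it can rise by
`2`, but a jump over `0` reveals a fixed letter `a` in `c`. -/
lemma slot_insertPos {c : Fin n → ℕ} {a : ℕ} (h : Even a ∨ NoFixed c a) :
    slot c a (insertPos c a) = insertPos c a := by
  have hle : slot c a (insertPos c a) ≤ insertPos c a := Nat.find_spec (exists_slot_le c a)
  obtain h0 | ⟨k, hk⟩ : (insertPos c a : ℕ) = 0 ∨ ∃ k, (insertPos c a : ℕ) = k + 1 := by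
    cases (insertPos c a : ℕ) <;> simp
  · omega
  have hlt := lt_slot_of_lt_insertPos (c := c) (a := a) (k := k) (by omega)
  have hkn : k < n := by have := (insertPos c a).2; omega
  rw [hk] at hle ⊢
  by_cases ha : Even a
  · have := slot_succ_of_even c ha ⟨k, hkn⟩
    simp only at this
    omega
  -- A jump means `slot c a k = k + 1` and `slot c a (k + 1) = k`; the latter is the rank of
  -- position `k`, whose letter is then a fixed `a`.
  · have hs := slot_succ_of_not_even c ha ⟨k, hkn⟩
    have hf := (h.resolve_left ha) ⟨k, hkn⟩
    have hr := rank_eq_slot_of_not_even c ⟨k, hkn⟩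
    unfold IsFixed at hf
    simp only at hs hf hr
    split_ifs at hs with he
    · rw [he] at hr
      have := hr ha
      have := hf he
      omega
    · omega

/-- Insert the letter `a` into `c` as a fixed position. -/
def insertFixed (a : ℕ) (c : Fin n → ℕ) : Fin (n + 1) → ℕ :=
  (insertPos c a).insertNth (α := fun _ => ℕ) a c

lemma isFixed_insertFixed {c : Fin n → ℕ} {a : ℕ} (h : Even a ∨ NoFixed c a) :
    IsFixed (insertFixed a c) (insertPos c a) := by
  unfold IsFixed insertFixed
  rw [rank_insertNth_self, slot_insertPos h]

/-- The inserted letter is the leftmost fixed `a`, so the insertion can be undone. -/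
lemma insertPos_le_of_isFixed {c : Fin n → ℕ} {a : ℕ} (h : Even a ∨ NoFixed c a)
    {k : Fin (n + 1)} (hk : insertFixed a c k = a) (hf : IsFixed (insertFixed a c) k) :
    insertPos c a ≤ k := by
  by_contra! hlt
  obtain ⟨i, rfl⟩ := Fin.exists_succAbove_eq hlt.ne
  unfold insertFixed at hk hf
  rw [isFixed_insertNth_succAbove (isFixed_insertFixed h)] at hf
  rw [Fin.insertNth_apply_succAbove] at hk
  have ha : Even a := h.resolve_right fun hn => hn i hk hf
  have hi : (i : ℕ) < insertPos c a := by
    have := (Fin.succAbove_lt_iff_castSucc_lt _ _).1 hlt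
    exact this
  have h₁ := lt_slot_of_lt_insertPos hi
  have h₂ := rank_eq_slot_of_even c i (hk ▸ ha)
  unfold IsFixed at hf
  rw [hk] at h₂
  omega

/-- The inverse of insertion: delete the leftmost fixed `a`. For odd `a` it is also the only one,
which is why nothing fixed with letter `a` remains. -/
lemma exists_insertFixed {d : Fin (n + 1) → ℕ} {a : ℕ} (h : ¬ NoFixed d a) :
    ∃ c : Fin n → ℕ, (Even a ∨ NoFixed c a) ∧ insertFixed a c = d := by
  have hex : ∃ k, d k = a ∧ IsFixed d k := by simpa [NoFixed] using h
  obtain ⟨k, ⟨hka, hkf⟩, hmin⟩ : ∃ k, (d k = a ∧ IsFixed d k) ∧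
      ∀ i < k, ¬ (d i = a ∧ IsFixed d i) := by
    refine ⟨Fin.find _ hex, Fin.find_spec hex, fun i hi => Fin.find_min hex hi⟩
  set c : Fin n → ℕ := k.removeNth (α := fun _ => ℕ) d with hc
  have hd : k.insertNth (α := fun _ => ℕ) a c = d := by
    rw [hc, ← hka, Fin.insertNth_self_removeNth]
  have hkf' : IsFixed (k.insertNth (α := fun _ => ℕ) a c) k := hd ▸ hkf
  have hslot : slot c a k = k := by rw [← rank_insertNth_self]; exact hkf'
  have hpos : insertPos c a = k := by
    refine insertPos_eq hslot.le fun i hi => ?_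
    by_cases ha : Even a
    -- The slot rises by at most `1` per step and equals `k` at `k`. So `slot c a i ≤ i` forces
    -- equality and a rise at every step from `i` on; hence position `i` carries a fixed `a`,
    -- further left than `k`.
    · by_contra! hle
      have hin : i < n := by omega
      have h₁ := slot_le_slot_add c ha (show i + 1 ≤ (k : ℕ) from hi) (by omega)
      have h₂ := slot_succ_of_even c ha ⟨i, hin⟩
      have h₃ := slot_le_slot_add c ha hi.le (by omega)
      simp only at h₂
      by_cases hci : c ⟨i, hin⟩ = a
      · have h₄ := rank_eq_slot_of_even c ⟨i, hin⟩ (hci ▸ ha)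
        rw [hci] at h₄
        have hlt : k.succAbove ⟨i, hin⟩ < k := (Fin.succAbove_lt_iff_castSucc_lt _ _).2 hi
        refine hmin _ hlt ⟨hci, ?_⟩
        rw [← hd, isFixed_insertNth_succAbove hkf']
        unfold IsFixed
        simp only at h₄ ⊢
        omega
      · rw [if_neg hci] at h₂
        omega
    · have := slot_antitone_of_not_even c ha hi.le
      omega
  refine ⟨c, ?_, by rw [insertFixed, hpos, hd]⟩
  by_cases ha : Even a
  · exact Or.inl ha
  · refine Or.inr fun i hi hf => ?_
    have h₄ := rank_eq_slot_of_not_even c i (hi ▸ ha)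
    have h₅ := slot_succ_of_not_even c ha i
    unfold IsFixed at hf
    rw [hi] at h₄
    rw [if_pos hi] at h₅
    rcases lt_or_ge (i : ℕ) k with hik | hik
    · have := slot_antitone_of_not_even c ha (show (i : ℕ) + 1 ≤ k from hik)
      omega
    · have := slot_antitone_of_not_even c ha hik
      omega

lemma insertFixed_injOn {a : ℕ} {c d : Fin n → ℕ} (hc : Even a ∨ NoFixed c a)
    (hd : Even a ∨ NoFixed d a) (h : insertFixed a c = insertFixed a d) : c = d := by
  have hpos : insertPos c a = insertPos d a := by
    apply le_antisymm
    · refine insertPos_le_of_isFixed hc ?_ ?_ <;> rw [h]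
      · simp [insertFixed]
      · exact isFixed_insertFixed hd
    · refine insertPos_le_of_isFixed hd ?_ ?_ <;> rw [← h]
      · simp [insertFixed]
      · exact isFixed_insertFixed hc
  unfold insertFixed at h
  rw [hpos] at h
  exact Fin.insertNth_right_injective _ h

end Rank

/-! ### Enumeration of words by letters and fixed positions -/

section Enumeration

variable {R : Type*} [CommRing R]

/-- Weight of a word: a factor `x a` for every letter `a`, and a factor `Y a` for every letter `a`
on a fixed position. -/
def wordWeight (x Y : ℕ → R) {n : ℕ} (c : Fin n → ℕ) : R :=
  ∏ i, (x (c i) * if IsFixed c i then Y (c i) else 1)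

/-- Words of length `n` over the alphabet `L`. -/
def words (L : Finset ℕ) (n : ℕ) : Finset (Fin n → ℕ) := Fintype.piFinset fun _ => L

/-- Sum of the weights of the words of length `n` over `L`. -/
def wordSum (L : Finset ℕ) (x Y : ℕ → R) (n : ℕ) : R := ∑ c ∈ words L n, wordWeight x Y c

/-- Sum of the weights of the words of length `n` over `L` that have no fixed letter `a`. -/
def noFixedSum (L : Finset ℕ) (a : ℕ) (x Y : ℕ → R) (n : ℕ) : R :=
  ∑ c ∈ words L n with NoFixed c a, wordWeight x Y c

lemma wordWeight_insertFixed (x Y : ℕ → R) {n : ℕ} {c : Fin n → ℕ} {a : ℕ}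
    (h : Even a ∨ NoFixed c a) :
    wordWeight x Y (insertFixed a c) = x a * Y a * wordWeight x Y c := by
  have hf := isFixed_insertFixed h
  unfold wordWeight
  rw [Fin.prod_univ_succAbove _ (insertPos c a), if_pos hf]
  congr 1
  · simp [insertFixed]
  · refine prod_congr rfl fun i _ => ?_
    unfold insertFixed at hf ⊢
    simp only [isFixed_insertNth_succAbove hf, Fin.insertNth_apply_succAbove]

lemma sum_not_noFixed (L : Finset ℕ) {a : ℕ} (haL : a ∈ L) (x Y : ℕ → R) (n : ℕ) :
    ∑ c ∈ words L (n + 1) with ¬ NoFixed c a, wordWeight x Y c =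
      x a * Y a * ∑ c ∈ words L n with Even a ∨ NoFixed c a, wordWeight x Y c := by
  rw [mul_sum]
  symm
  refine sum_bij (fun c _ => insertFixed a c) ?_ ?_ ?_ ?_
  · intro c hc
    simp only [mem_filter, words, Fintype.mem_piFinset] at hc ⊢
    refine ⟨fun i => ?_, fun hn => hn _ (by simp [insertFixed]) (isFixed_insertFixed hc.2)⟩
    refine Fin.succAboveCases (insertPos c a) ?_ (fun j => ?_) i
    · simpa [insertFixed] using haL
    · simpa [insertFixed] using hc.1 j
  · intro c hc d hd h
    exact insertFixed_injOn (mem_filter.1 hc).2 (mem_filter.1 hd).2 h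
  · intro d hd
    obtain ⟨hd, hn⟩ := mem_filter.1 hd
    obtain ⟨c, hc, rfl⟩ := exists_insertFixed hn
    refine ⟨c, mem_filter.2 ⟨?_, hc⟩, rfl⟩
    simp only [words, Fintype.mem_piFinset] at hd ⊢
    intro i
    simpa [insertFixed] using hd ((insertPos c a).succAbove i)
  · intro c hc
    exact (wordWeight_insertFixed x Y (mem_filter.1 hc).2).symm

lemma wordSum_succ (L : Finset ℕ) {a : ℕ} (haL : a ∈ L) (x Y : ℕ → R) (n : ℕ) :
    wordSum L x Y (n + 1) = noFixedSum L a x Y (n + 1) +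
      x a * Y a * if Even a then wordSum L x Y n else noFixedSum L a x Y n := by
  rw [wordSum, ← sum_filter_add_sum_filter_not _ (fun c => NoFixed c a),
    sum_not_noFixed L haL, noFixedSum]
  split_ifs with ha <;> simp [ha, wordSum, noFixedSum]

/-- `Y a` never enters a weight in this sum. It is the common quantity through which two values of
`Y a` are compared. -/
lemma noFixedSum_congr (L : Finset ℕ) (a : ℕ) (x : ℕ → R) {Y Y' : ℕ → R}
    (h : ∀ b ≠ a, Y b = Y' b) (n : ℕ) : noFixedSum L a x Y n = noFixedSum L a x Y' n := by
  refine sum_congr rfl fun c hc => prod_congr rfl fun i _ => ?_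
  have hn := (mem_filter.1 hc).2 i
  by_cases hi : c i = a
  · simp [hn hi]
  · rw [h _ hi]

lemma noFixedSum_zero (L : Finset ℕ) (a : ℕ) (x Y : ℕ → R) : noFixedSum L a x Y 0 = 1 := by
  simp [noFixedSum, words, wordWeight, NoFixed, Finset.filter_singleton]

lemma wordSum_zero (L : Finset ℕ) (x Y : ℕ → R) : wordSum L x Y 0 = 1 := by
  simp [wordSum, words, wordWeight]

lemma wordSum_one (L : Finset ℕ) (x : ℕ → R) (n : ℕ) :
    wordSum L x (fun _ => 1) n = (∑ a ∈ L, x a) ^ n := by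
  simp only [wordSum, words, wordWeight, ite_self, mul_one]
  rw [← prod_univ_sum]
  simp

end Enumeration

/-! ### Generating series of words -/

section WordSeries

lemma coeff_X_pow_mul_eq_zero {v : Var} {n : ℕ} {m : Var →₀ ℕ} (h : m v < n) (f : Series) :
    MvPowerSeries.coeff m (sX v ^ n * f) = 0 :=
  MvPowerSeries.X_pow_dvd_iff.1 (dvd_mul_right _ f) m h

lemma summable_X_pow_mul (v : Var) (f : ℕ → Series) : Summable fun n => sX v ^ n * f n := by
  rw [MvPowerSeries.WithPiTopology.summable_iff_summable_coeff]
  refine fun m => summable_of_ne_finset_zero (s := range (m v + 1)) fun n hn => ?_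
  exact coeff_X_pow_mul_eq_zero (by simpa using hn) _

/-- The series `∑ f_n u ^ n`. -/
noncomputable def uSeries (f : ℕ → Series) : Series := ∑' n, sX .u ^ n * f n

lemma uSeries_eq (f : ℕ → Series) : uSeries f = f 0 + sX .u * uSeries fun n => f (n + 1) := by
  rw [uSeries, (summable_X_pow_mul .u f).tsum_eq_zero_add, uSeries,
    ← (summable_X_pow_mul .u _).tsum_mul_left]
  simp [pow_succ', mul_assoc]

lemma uSeries_add_mul (c : Series) (f g : ℕ → Series) :
    uSeries (fun n => f n + c * g n) = uSeries f + c * uSeries g := by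
  simp only [uSeries]
  rw [← (summable_X_pow_mul .u g).tsum_mul_left, ← (summable_X_pow_mul .u f).tsum_add
    ((summable_X_pow_mul .u g).mul_left c)]
  exact tsum_congr fun n => by ring

lemma uSeries_pow_mul (a : Series) : uSeries (fun n => a ^ n) * (1 - sX .u * a) = 1 := by
  have h := uSeries_eq fun n => a ^ n
  have h' := uSeries_add_mul a (fun _ => 0) fun n => a ^ n
  have h0 : uSeries (fun _ => 0) = 0 := by simp [uSeries]
  simp only [pow_succ', pow_zero, zero_add, h0] at h h'
  rw [h'] at h
  linear_combination h

/-- The denominator contributed by the letter `a`. -/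
noncomputable def letterDen (x Y : ℕ → Series) (a : ℕ) : Series :=
  if Even a then 1 - sX .u * (x a * Y a) else 1 + sX .u * x a

/-- The numerator contributed by the letter `a`. -/
noncomputable def letterNum (x Y : ℕ → Series) (a : ℕ) : Series :=
  if Even a then 1 - sX .u * x a else 1 + sX .u * (x a * Y a)

lemma uSeries_wordSum_of_even {L : Finset ℕ} {a : ℕ} (haL : a ∈ L) (ha : Even a)
    (x Y : ℕ → Series) :
    uSeries (wordSum L x Y) * (1 - sX .u * (x a * Y a)) = uSeries (noFixedSum L a x Y) := by
  have h₁ := uSeries_eq (wordSum L x Y)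
  have h₂ := uSeries_eq (noFixedSum L a x Y)
  simp only [wordSum_succ L haL, ha, if_true, uSeries_add_mul, wordSum_zero,
    noFixedSum_zero] at h₁ h₂
  linear_combination h₁ - h₂

lemma uSeries_wordSum_of_not_even {L : Finset ℕ} {a : ℕ} (haL : a ∈ L) (ha : ¬ Even a)
    (x Y : ℕ → Series) :
    uSeries (wordSum L x Y) = uSeries (noFixedSum L a x Y) * (1 + sX .u * (x a * Y a)) := by
  have h₁ := uSeries_eq (wordSum L x Y)
  have h₂ := uSeries_eq (noFixedSum L a x Y)
  simp only [wordSum_succ L haL, ha, if_false, uSeries_add_mul, wordSum_zero,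
    noFixedSum_zero] at h₁ h₂
  linear_combination h₁ - h₂

/-- Both series are multiples of the same series of words without fixed `a`. The cross-multiplied
form avoids inverses. -/
lemma uSeries_wordSum_update {L : Finset ℕ} {a : ℕ} (haL : a ∈ L) (x : ℕ → Series)
    {Y Y' : ℕ → Series} (h : ∀ b ≠ a, Y b = Y' b) (h1 : Y' a = 1) :
    uSeries (wordSum L x Y) * letterDen x Y a = uSeries (wordSum L x Y') * letterNum x Y a := by
  have hD : noFixedSum L a x Y = noFixedSum L a x Y' := funext (noFixedSum_congr L a x h)
  unfold letterDen letterNum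
  split_ifs with ha
  · rw [uSeries_wordSum_of_even haL ha, hD, ← uSeries_wordSum_of_even haL ha, h1, mul_one]
  · rw [uSeries_wordSum_of_not_even haL ha, uSeries_wordSum_of_not_even haL ha x Y', hD, h1]
    ring

theorem uSeries_wordSum (L : Finset ℕ) (x Y : ℕ → Series) :
    uSeries (wordSum L x Y) * ((1 - sX .u * ∑ a ∈ L, x a) * ∏ a ∈ L, letterDen x Y a) =
      ∏ a ∈ L, letterNum x Y a := by
  -- `T` is the set of letters whose `Y` has been switched on; the others have `Y = 1`.
  have key : ∀ T ⊆ L, uSeries (wordSum L x fun a => if a ∈ T then Y a else 1) *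
      ∏ a ∈ T, letterDen x Y a = uSeries (wordSum L x fun _ => 1) * ∏ a ∈ T, letterNum x Y a := by
    intro T
    induction T using Finset.induction_on with
    | empty => simp
    | insert a T haT ih =>
      intro hT
      have ih := ih ((subset_insert _ _).trans hT)
      have hs := uSeries_wordSum_update (hT (mem_insert_self a T)) x
        (Y := fun b => if b ∈ insert a T then Y b else 1) (Y' := fun b => if b ∈ T then Y b else 1)
        (fun b hb => by simp [hb]) (by simp [haT])
      have hD : letterDen x (fun b => if b ∈ insert a T then Y b else 1) a = letterDen x Y a := by
        simp [letterDen]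
      have hN : letterNum x (fun b => if b ∈ insert a T then Y b else 1) a = letterNum x Y a := by
        simp [letterNum]
      rw [hD, hN] at hs
      rw [prod_insert haT, prod_insert haT]
      linear_combination (∏ b ∈ T, letterDen x Y b) * hs + letterNum x Y a * ih
  have hL := key L subset_rfl
  have hY : wordSum L x (fun a => if a ∈ L then Y a else 1) = wordSum L x Y := by
    funext n
    refine sum_congr rfl fun c hc => prod_congr rfl fun i _ => ?_
    simp only [if_pos (Fintype.mem_piFinset.1 hc i)]
  have h1 : uSeries (wordSum L x fun _ => 1) * (1 - sX .u * ∑ a ∈ L, x a) = 1 := by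
    rw [show (wordSum L x fun _ => 1) = fun n => (∑ a ∈ L, x a) ^ n from funext (wordSum_one L x),
      uSeries_pow_mul]
  rw [hY] at hL
  linear_combination (1 - sX .u * ∑ a ∈ L, x a) * hL + (∏ a ∈ L, letterNum x Y a) * h1

/-- The weight of the letter `a`. -/
noncomputable def letterX (a : ℕ) : Series := sX .q ^ a * sX .Z ^ (if Odd a then 1 else 0)

/-- The weight of a fixed letter `a`. -/
noncomputable def letterY (a : ℕ) : Series := if Even a then sX .Y₀ else sX .Y₁

lemma letterX_two_mul (i : ℕ) : letterX (2 * i) = (sX .q ^ 2) ^ i := by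
  simp [letterX, pow_mul]

lemma letterX_two_mul_add_one (i : ℕ) :
    letterX (2 * i + 1) = sX .q * sX .Z * (sX .q ^ 2) ^ i := by
  simp [letterX, pow_succ, pow_mul]
  ring

lemma prod_range_parity (f : ℕ → Series) (s : ℕ) :
    ∏ a ∈ range (s + 1), f a =
      (∏ i ∈ range (s / 2 + 1), f (2 * i)) * ∏ i ∈ range ((s + 1) / 2), f (2 * i + 1) := by
  induction s with
  | zero => simp
  | succ s ih =>
    rw [prod_range_succ, ih]
    obtain ⟨k, rfl | rfl⟩ := Nat.even_or_odd' s
    · rw [show (2 * k + 1 + 1) / 2 = k + 1 by omega, show (2 * k + 1) / 2 = k by omega,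
        show 2 * k / 2 = k by omega, prod_range_succ (fun i => f (2 * i + 1))]
      ring
    · rw [show (2 * k + 1 + 1 + 1) / 2 = k + 1 by omega, show (2 * k + 1 + 1) / 2 = k + 1 by omega,
        show (2 * k + 1) / 2 = k by omega, prod_range_succ (fun i => f (2 * i)) (k + 1)]
      ring_nf

lemma prod_letterDen (s : ℕ) : ∏ a ∈ range (s + 1), letterDen letterX letterY a =
    poch (sX .u * sX .Y₀) (sX .q ^ 2) (s / 2 + 1) *
      poch (-(sX .u * sX .q * sX .Z)) (sX .q ^ 2) ((s + 1) / 2) := by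
  rw [prod_range_parity, poch, poch]
  congr 1 <;> refine prod_congr rfl fun i _ => ?_
  · simp [letterDen, letterX_two_mul, letterY]
    ring
  · simp [letterDen, letterX_two_mul_add_one]
    ring

lemma prod_letterNum (s : ℕ) : ∏ a ∈ range (s + 1), letterNum letterX letterY a =
    poch (sX .u) (sX .q ^ 2) (s / 2 + 1) *
      poch (-(sX .u * sX .q * sX .Y₁ * sX .Z)) (sX .q ^ 2) ((s + 1) / 2) := by
  rw [prod_range_parity, poch, poch]
  congr 1 <;> refine prod_congr rfl fun i _ => ?_
  · simp [letterNum, letterX_two_mul]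
  · simp [letterNum, letterX_two_mul_add_one, letterY]
    ring

lemma constantCoeff_poch {a : Series} (ha : MvPowerSeries.constantCoeff a = 0) (p : Series)
    (n : ℕ) : MvPowerSeries.constantCoeff (poch a p n) = 1 := by
  simp [poch, ha]

theorem uSeries_wordSum_eq_gradedTerm (s : ℕ) :
    uSeries (wordSum (range (s + 1)) letterX letterY) = gradedTerm s := by
  have h := uSeries_wordSum (range (s + 1)) letterX letterY
  rw [prod_letterDen, prod_letterNum] at h
  have e₁ := MvPowerSeries.mul_inv_cancel (1 - sX .u * ∑ a ∈ range (s + 1), letterX a) (by simp)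
  have e₂ := MvPowerSeries.mul_inv_cancel (poch (sX .u * sX .Y₀) (sX .q ^ 2) (s / 2 + 1))
    (by rw [constantCoeff_poch (by simp)]; simp)
  have e₃ := MvPowerSeries.mul_inv_cancel
    (poch (-(sX .u * sX .q * sX .Z)) (sX .q ^ 2) ((s + 1) / 2))
    (by rw [constantCoeff_poch (by simp)]; simp)
  change _ = (1 - sX .u * ∑ a ∈ range (s + 1), letterX a)⁻¹ * _ * _
  set A := 1 - sX .u * ∑ a ∈ range (s + 1), letterX a
  set P := poch (sX .u * sX .Y₀) (sX .q ^ 2) (s / 2 + 1)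
  set Q := poch (-(sX .u * sX .q * sX .Z)) (sX .q ^ 2) ((s + 1) / 2)
  calc uSeries (wordSum (range (s + 1)) letterX letterY)
      = uSeries (wordSum (range (s + 1)) letterX letterY) * ((A * A⁻¹) * (P * P⁻¹) * (Q * Q⁻¹)) := by
        rw [e₁, e₂, e₃]; ring
    _ = uSeries (wordSum (range (s + 1)) letterX letterY) * (A * (P * Q)) * (A⁻¹ * P⁻¹ * Q⁻¹) := by
        ring
    _ = _ := by rw [h]; ring

end WordSeries

/-! ### Words and signed permutations -/

section Sorting

variable {n : ℕ}

lemma mem_signedPerms_iff {w : Fin n → ℤ} :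
    w ∈ signedPerms n ↔ ∃ σ : Equiv.Perm (Fin n), ∀ i, (w i).natAbs = σ i + 1 := by
  simp only [signedPerms, mem_filter, Fintype.mem_piFinset, mem_Icc]
  constructor
  · rintro ⟨-, h⟩
    have hinj : Function.Injective fun i => (w i).natAbs := by
      have := card_image_iff.1 (show (univ.image fun i => (w i).natAbs).card = univ.card by simp [h])
      simpa [Set.injOn_univ] using this
    have hmem : ∀ i, 1 ≤ (w i).natAbs ∧ (w i).natAbs ≤ n := fun i => by
      have : (w i).natAbs ∈ univ.image fun i => (w i).natAbs := mem_image_of_mem _ (mem_univ i)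
      rwa [h, mem_Icc] at this
    let f : Fin n → Fin n := fun i => ⟨(w i).natAbs - 1, by have := hmem i; omega⟩
    have hf : Function.Injective f := fun i j hij => hinj <| by
      have := hmem i
      have := hmem j
      have : (w i).natAbs - 1 = (w j).natAbs - 1 := congrArg Fin.val hij
      simp only
      omega
    refine ⟨Equiv.ofBijective f (Finite.injective_iff_bijective.1 hf), fun i => ?_⟩
    have := hmem i
    simp only [Equiv.ofBijective_apply, f]
    omega
  · rintro ⟨σ, h⟩
    refine ⟨fun i => ?_, ?_⟩
    · have := h i
      have := (σ i).2
      omega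
    · ext k
      simp only [mem_image, mem_univ, true_and, mem_Icc, h]
      constructor
      · rintro ⟨i, rfl⟩
        have := (σ i).2
        omega
      · intro hk
        refine ⟨σ.symm ⟨k - 1, by omega⟩, ?_⟩
        simp only [Equiv.apply_symm_apply]
        omega

lemma rank_lt (c : Fin n → ℕ) (k : Fin n) : rank c k < n := by
  have : rank c k < #(univ : Finset (Fin n)) :=
    card_lt_card ⟨subset_univ _, fun h => not_precedes_self c k (by simpa using h (mem_univ k))⟩
  simpa using this

lemma rank_injective (c : Fin n → ℕ) : Function.Injective (rank c) := fun j k h => by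
  by_contra hjk
  rcases precedes_or_precedes c hjk with h' | h' <;> have := h'.rank_lt <;> omega

/-- The permutation that lists the positions of `c` in sorted order. -/
noncomputable def sortPerm (c : Fin n → ℕ) : Equiv.Perm (Fin n) :=
  (Equiv.ofBijective (fun k => (⟨rank c k, rank_lt c k⟩ : Fin n))
    (Finite.injective_iff_bijective.1 fun _ _ h => rank_injective c (congrArg Fin.val h))).symm

lemma rank_sortPerm (c : Fin n → ℕ) (i : Fin n) : rank c (sortPerm c i) = i :=
  congrArg Fin.val ((sortPerm c).symm_apply_apply i)

lemma precedes_sortPerm (c : Fin n → ℕ) {i j : Fin n} (h : i < j) :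
    Precedes c (sortPerm c i) (sortPerm c j) := by
  refine (precedes_or_precedes c ((sortPerm c).injective.ne h.ne)).resolve_right fun h' => ?_
  have := h'.rank_lt
  rw [rank_sortPerm, rank_sortPerm] at this
  exact absurd h (by simpa using this.le)

/-- In an enumeration increasing for a strict total order, the rank of the `i`-th element is `i`. -/
lemma sortPerm_eq {c : Fin n → ℕ} {τ : Equiv.Perm (Fin n)}
    (h : ∀ i j, i < j → Precedes c (τ i) (τ j)) : sortPerm c = τ := by
  ext1 i
  apply rank_injective c
  rw [rank_sortPerm, rank, ← Fin.card_Iio i]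
  refine card_equiv τ fun j => ?_
  simp only [mem_Iio, mem_filter, mem_univ, true_and]
  refine ⟨h j i, fun hp => ?_⟩
  by_contra! hle
  rcases hle.eq_or_lt with rfl | hlt
  · exact not_precedes_self _ _ hp
  · exact not_precedes_self _ _ (hp.trans (h i j hlt))

lemma isFixed_sortPerm (c : Fin n → ℕ) (i : Fin n) :
    IsFixed c (sortPerm c i) ↔ sortPerm c i = i := by
  rw [IsFixed, rank_sortPerm, Fin.ext_iff, eq_comm]

/-- The signed permutation that sorts `c`: odd letters give negative entries. -/
noncomputable def signedSort (c : Fin n → ℕ) (i : Fin n) : ℤ :=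
  if Even (c (sortPerm c i)) then (sortPerm c i : ℤ) + 1 else -((sortPerm c i : ℤ) + 1)

lemma natAbs_signedSort (c : Fin n → ℕ) (i : Fin n) :
    (signedSort c i).natAbs = sortPerm c i + 1 := by
  unfold signedSort
  split_ifs <;> omega

lemma signedSort_mem (c : Fin n → ℕ) : signedSort c ∈ signedPerms n :=
  mem_signedPerms_iff.2 ⟨sortPerm c, natAbs_signedSort c⟩

/-- The word `b` is weakly decreasing, decreases strictly at the descents of `w`, and is odd
exactly at the negative entries of `w`. -/
def Compatible (w : Fin n → ℤ) (b : Fin n → ℕ) : Prop :=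
  (∀ i, Odd (b i) ↔ w i < 0) ∧
    ∀ i j : Fin n, (i : ℕ) + 1 = j → b j ≤ b i ∧ (w j < w i → b j < b i)

/-- The tie rule is made for this: along a run of equal even letters the positions increase, and
along a run of equal odd letters the positions decrease, so their negatives increase. Hence `w` has
no descent inside a run. -/
lemma compatible_signedSort (c : Fin n → ℕ) : Compatible (signedSort c) (c ∘ sortPerm c) := by
  refine ⟨fun i => ?_, fun i j hij => ?_⟩
  · simp only [Function.comp_apply, signedSort, ← Nat.not_even_iff_odd]
    split_ifs with h <;> simp only [h] <;> simp <;> omega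
  · have h := precedes_sortPerm c (show i < j by rw [Fin.lt_def]; omega)
    simp only [Function.comp_apply, signedSort]
    rcases h with h | ⟨e, h⟩
    · exact ⟨h.le, fun _ => h⟩
    · rw [e]
      refine ⟨le_rfl, fun hw => ?_⟩
      split_ifs at h hw <;> rw [Fin.lt_def] at h <;> omega

lemma Compatible.lt_or_eq {w : Fin n → ℤ} {b : Fin n → ℕ} (h : Compatible w b)
    (hw : Function.Injective w) {i j : Fin n} (hij : i < j) :
    b j < b i ∨ (b i = b j ∧ w i < w j) := by
  obtain ⟨i, hi⟩ := i
  obtain ⟨j, hj⟩ := j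
  rw [Fin.mk_lt_mk] at hij
  have step : ∀ k (hk : k + 1 < n), b ⟨k + 1, hk⟩ < b ⟨k, by omega⟩ ∨
      (b ⟨k, by omega⟩ = b ⟨k + 1, hk⟩ ∧ w ⟨k, by omega⟩ < w ⟨k + 1, hk⟩) := fun k hk => by
    have h₁ := h.2 ⟨k, by omega⟩ ⟨k + 1, hk⟩ rfl
    have h₂ : w ⟨k, by omega⟩ ≠ w ⟨k + 1, hk⟩ := hw.ne (by simp)
    omega
  induction j, hij using Nat.le_induction with
  | base => exact step i hj
  | succ j hij ih =>
    have h₁ := ih (by omega) step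
    have h₂ := step j hj
    omega

lemma injective_of_mem_signedPerms {w : Fin n → ℤ} (hw : w ∈ signedPerms n) :
    Function.Injective w := by
  obtain ⟨σ, hσ⟩ := mem_signedPerms_iff.1 hw
  intro i j hij
  have h₁ := hσ i
  have h₂ := hσ j
  rw [hij] at h₁
  exact σ.injective (Fin.ext (by omega))

/-- The word `c` is recovered by putting the letter `b i` at position `|w i|`. Compatibility says
exactly that `|w|` then lists the positions in sorted order. -/
lemma exists_signedSort {w : Fin n → ℤ} (hw : w ∈ signedPerms n) {b : Fin n → ℕ}
    (h : Compatible w b) : ∃ c : Fin n → ℕ, signedSort c = w ∧ c ∘ sortPerm c = b := by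
  obtain ⟨τ, hτ⟩ := mem_signedPerms_iff.1 hw
  have hs : sortPerm (b ∘ τ.symm) = τ := by
    refine sortPerm_eq fun i j hij => ?_
    have hb := h.lt_or_eq (injective_of_mem_signedPerms hw) hij
    unfold Precedes
    simp only [Function.comp_apply, Equiv.symm_apply_apply]
    refine hb.imp_right fun ⟨e, hlt⟩ => ⟨e, ?_⟩
    have h₁ := h.1 i
    have h₂ := h.1 j
    have h₃ := hτ i
    have h₄ := hτ j
    rw [e] at h₁
    rw [← Nat.not_even_iff_odd] at h₁ h₂
    split_ifs with he <;> simp only [he, not_true, not_false_iff, true_iff, false_iff] at h₁ h₂ <;>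
      rw [Fin.lt_def] <;> omega
  refine ⟨b ∘ τ.symm, funext fun i => ?_, by rw [hs]; ext; simp⟩
  have h₁ := h.1 i
  have h₃ := hτ i
  rw [← Nat.not_even_iff_odd] at h₁
  simp only [signedSort, hs, Function.comp_apply, Equiv.symm_apply_apply]
  split_ifs with he <;> simp only [he, not_true, not_false_iff, true_iff, false_iff] at h₁ <;> omega

lemma signedSort_injective {c d : Fin n → ℕ} (h : signedSort c = signedSort d)
    (hb : c ∘ sortPerm c = d ∘ sortPerm d) : c = d := by
  have hs : sortPerm c = sortPerm d := by
    ext i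
    have h₁ := natAbs_signedSort c i
    have h₂ := natAbs_signedSort d i
    rw [h] at h₁
    omega
  rw [hs] at hb
  exact (sortPerm d).surjective.injective_comp_right hb

end Sorting

/-! ### Transfer of weights from words to signed permutations -/

section Weights

variable {n : ℕ}

/-- The monomial that records the fixed points and the signs of a signed permutation. -/
noncomputable def signWeight (w : Fin n → ℤ) : Series :=
  sX .Y₀ ^ fixPos w * sX .Y₁ ^ fixNeg w * sX .Z ^ neg w

lemma wordWeight_eq (c : Fin n → ℕ) : wordWeight letterX letterY c =
    signWeight (signedSort c) * sX .q ^ (∑ i, (c ∘ sortPerm c) i) := by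
  have h : ∀ i, letterX (c (sortPerm c i)) *
      (if IsFixed c (sortPerm c i) then letterY (c (sortPerm c i)) else 1) =
      (if signedSort c i = ((i : ℕ) : ℤ) + 1 then sX .Y₀ else 1) *
      (if signedSort c i = -(((i : ℕ) : ℤ) + 1) then sX .Y₁ else 1) *
      (if signedSort c i < 0 then sX .Z else 1) * sX .q ^ (c (sortPerm c i)) := by
    intro i
    simp only [isFixed_sortPerm, letterX, letterY, signedSort, ← Nat.not_even_iff_odd, Fin.ext_iff]
    by_cases he : Even (c (sortPerm c i)) <;> by_cases hi : (sortPerm c i : ℕ) = i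
    · simp [he, hi, show ¬ ((i : ℤ) + 1 = -1 + -i) by omega, show ¬ ((i : ℤ) + 1 < 0) by omega]
      ring
    · simp [he, hi, show ¬ ((sortPerm c i : ℤ) + 1 = -1 + -i) by omega,
        show ¬ ((sortPerm c i : ℤ) + 1 < 0) by omega]
    · simp [he, hi, show ¬ (-1 + -(i : ℤ) = i + 1) by omega, show (-1 + -(i : ℤ) < 0) by omega]
      ring
    · simp [he, hi, show ¬ (-1 + -(sortPerm c i : ℤ) = i + 1) by omega,
        show (-1 + -(sortPerm c i : ℤ) < 0) by omega]
      ring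
  -- Reading the positions in sorted order matches the `i`-th factor with the `i`-th entry of the
  -- signed permutation.
  rw [wordWeight, ← Equiv.prod_comp (sortPerm c), prod_congr rfl fun i _ => h i]
  simp only [prod_mul_distrib, prod_ite, prod_const, one_pow, mul_one, prod_pow_eq_pow_sum,
    signWeight, fixPos, fixNeg, neg, Function.comp_apply]

instance (w : Fin n → ℤ) (b : Fin n → ℕ) : Decidable (Compatible w b) := by
  unfold Compatible; infer_instance

lemma wordSum_eq_sum_signedPerms (L : Finset ℕ) : wordSum L letterX letterY n =
    ∑ w ∈ signedPerms n, signWeight w *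
      ∑ b ∈ words L n with Compatible w b, sX .q ^ (∑ i, b i) := by
  simp only [mul_sum]
  rw [sum_sigma', wordSum]
  refine sum_bij (fun c _ => ⟨signedSort c, c ∘ sortPerm c⟩) ?_ ?_ ?_ ?_
  · intro c hc
    simp only [words, mem_sigma, mem_filter, Fintype.mem_piFinset] at hc ⊢
    exact ⟨signedSort_mem c, fun i => hc _, compatible_signedSort c⟩
  · intro c _ d _ h
    simp only [Sigma.mk.injEq, heq_eq_eq] at h
    exact signedSort_injective h.1 h.2
  · rintro ⟨w, b⟩ h
    simp only [words, mem_sigma, mem_filter, Fintype.mem_piFinset] at h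
    obtain ⟨c, rfl, rfl⟩ := exists_signedSort h.1 h.2.2
    refine ⟨c, Fintype.mem_piFinset.2 fun k => ?_, rfl⟩
    simpa using h.2.1 ((sortPerm c).symm k)
  · intro c _
    exact wordWeight_eq c

end Weights

/-! ### Sorted words compatible with a signed permutation -/

section Compatible

variable {n : ℕ}

/-- The smallest word compatible with `w`. -/
def minWord (w : Fin n → ℤ) (i : Fin n) : ℕ :=
  2 * #{j ∈ descents w | i ≤ j} + if w i < 0 then 1 else 0

lemma card_descents_ge (w : Fin n → ℤ) {i j : Fin n} (hij : (i : ℕ) + 1 = j) :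
    #{k ∈ descents w | i ≤ k} = #{k ∈ descents w | j ≤ k} + if w j < w i then 1 else 0 := by
  have hd : i ∈ descents w ↔ w j < w i := by
    have hj : j = ⟨(i : ℕ) + 1, hij ▸ j.2⟩ := Fin.ext hij.symm
    have hi : (i : ℕ) + 1 < n := hij ▸ j.2
    simp [descents, hj, hi]
  have hset : ({k ∈ descents w | i ≤ k} : Finset (Fin n)) =
      {k ∈ descents w | j ≤ k} ∪ if w j < w i then {i} else ∅ := by
    ext k
    have : i ≤ k ↔ j ≤ k ∨ k = i := by
      rw [Fin.le_def, Fin.le_def, Fin.ext_iff]; omega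
    split_ifs with h <;> simp only [mem_filter, mem_union, mem_singleton, notMem_empty, this]
    · constructor
      · tauto
      · rintro (h' | rfl) <;> tauto
    · constructor
      · rintro ⟨h₁, h₂ | rfl⟩ <;> tauto
      · tauto
  rw [hset, card_union_of_disjoint]
  · split_ifs <;> simp
  · split_ifs
    · simp only [disjoint_singleton_right, mem_filter, not_and]
      intro _
      rw [Fin.le_def]
      omega
    · simp

lemma card_descents_ge_last (w : Fin n → ℤ) {i : Fin n} (hi : (i : ℕ) + 1 = n) :
    #{k ∈ descents w | i ≤ k} = 0 := by
  rw [card_eq_zero, filter_eq_empty_iff]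
  intro k hk hik
  obtain ⟨h, -⟩ := (mem_filter.1 hk).2
  rw [Fin.le_def] at hik
  omega

/-- Compatibility prescribes the parity of each letter, and `minWord w` makes the smallest drops
that parity and descents permit. What remains after subtracting it is even, nonnegative and weakly
decreasing. -/
lemma compatible_iff {w : Fin n → ℤ} (hw : Function.Injective w) {b : Fin n → ℕ} :
    Compatible w b ↔ ∃ l : Fin n → ℕ, Antitone l ∧ b = fun i => minWord w i + 2 * l i := by
  have anti : ∀ l : Fin n → ℕ, (∀ i j : Fin n, (i : ℕ) + 1 = j → l j ≤ l i) → Antitone l := by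
    rintro l hl ⟨i, hi⟩ ⟨j, hj⟩ hij
    rw [Fin.mk_le_mk] at hij
    induction j, hij using Nat.le_induction with
    | base => rfl
    | succ j _ ih => exact (hl ⟨j, by omega⟩ ⟨j + 1, hj⟩ rfl).trans (ih (by omega))
  constructor
  · rintro ⟨hodd, hb⟩
    have hmod : ∀ i, b i % 2 = if w i < 0 then 1 else 0 := fun i => by
      have := hodd i
      rw [Nat.odd_iff] at this
      split_ifs <;> omega
    -- Every drop of `b` is at least that of `minWord w`: at a descent between entries of equal sign
    -- the drop is positive and even, hence at least `2`; where the sign changes it is odd, hence at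
    -- least `1`.
    have step : ∀ i j : Fin n, (i : ℕ) + 1 = j → minWord w i + b j ≤ minWord w j + b i := by
      intro i j hij
      have h₁ := hb i j hij
      have h₂ := hmod i
      have h₃ := hmod j
      have h₄ : w i ≠ w j := hw.ne (by rw [Ne, Fin.ext_iff]; omega)
      simp only [minWord, card_descents_ge w hij]
      split_ifs at * <;> omega
    have hle : ∀ k (i : Fin n), (i : ℕ) + 1 + k = n → minWord w i ≤ b i := by
      intro k
      induction k with
      | zero =>
        intro i hi
        have := hmod i
        rw [minWord, card_descents_ge_last w hi]
        omega
      | succ k ih =>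
        intro i hi
        have h₁ := step i ⟨i + 1, by omega⟩ rfl
        have h₂ := ih ⟨i + 1, by omega⟩ (by simp only; omega)
        omega
    have hle' : ∀ i, minWord w i ≤ b i := fun i => hle (n - (i + 1)) i (by omega)
    refine ⟨fun i => (b i - minWord w i) / 2, anti _ fun i j hij => ?_, funext fun i => ?_⟩
    · have := step i j hij
      have := hle' j
      omega
    · have := hle' i
      have := hmod i
      have hm : minWord w i % 2 = if w i < 0 then 1 else 0 := by
        rw [minWord]
        split_ifs <;> omega
      change b i = minWord w i + 2 * ((b i - minWord w i) / 2)
      omega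
  · rintro ⟨l, hl, rfl⟩
    refine ⟨fun i => ?_, fun i j hij => ?_⟩
    · simp only [Nat.odd_iff, minWord]
      split_ifs with h <;> omega
    · have h₁ : l j ≤ l i := hl (by rw [Fin.le_def]; omega)
      have h₄ : w i ≠ w j := hw.ne (by rw [Ne, Fin.ext_iff]; omega)
      simp only [minWord, card_descents_ge w hij]
      split_ifs <;> omega

/-- Double count: the descent at index `j` contributes to the `j + 1` indices `i ≤ j`. -/
lemma sum_minWord (w : Fin n → ℤ) : ∑ i, minWord w i = fmaj w := by
  have h : ∑ i, #{j ∈ descents w | i ≤ j} = maj w := by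
    simp only [card_eq_sum_ones, sum_filter]
    rw [sum_comm, maj]
    refine sum_congr rfl fun j _ => ?_
    rw [← card_filter, ← Fin.card_Iic j]
    congr 1
    ext
    simp
  simp only [minWord, sum_add_distrib, ← mul_sum, h, fmaj, neg, card_filter _ univ]

lemma minWord_zero (w : Fin n → ℤ) (h : 0 < n) : minWord w ⟨0, h⟩ = fdes w := by
  have : ({j ∈ descents w | ⟨0, h⟩ ≤ j} : Finset (Fin n)) = descents w :=
    filter_true_of_mem fun j _ => Fin.le_def.2 (Nat.zero_le _)
  simp [minWord, fdes, des, this, h]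

lemma fdes_of_eq_zero (w : Fin 0 → ℤ) : fdes w = 0 := by
  simp [fdes, des, descents]

/-- Partitions into `n` parts, zero allowed, each at most `m`. -/
def parts (n m : ℕ) : Finset (Fin n → ℕ) := {l ∈ words (range (m + 1)) n | Antitone l}

/-- Generating polynomial of `parts n m` by size, a Gaussian binomial coefficient. -/
noncomputable def partSum (p : Series) (n m : ℕ) : Series := ∑ l ∈ parts n m, p ^ ∑ i, l i

lemma mem_parts {m : ℕ} {l : Fin n → ℕ} : l ∈ parts n m ↔ (∀ i, l i ≤ m) ∧ Antitone l := by
  simp [parts, words]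

lemma sum_compatible {w : Fin n → ℤ} (hw : Function.Injective w) (s : ℕ) :
    ∑ b ∈ words (range (s + 1)) n with Compatible w b, sX .q ^ (∑ i, b i) =
      if fdes w ≤ s then sX .q ^ fmaj w * partSum (sX .q ^ 2) n ((s - fdes w) / 2) else 0 := by
  have hbound : ∀ l : Fin n → ℕ, Antitone l →
      ((∀ i, minWord w i + 2 * l i < s + 1) ↔ fdes w ≤ s ∧ ∀ i, l i ≤ (s - fdes w) / 2) := by
    intro l hl
    -- The empty word has no first letter to carry the bound; there `fdes w = 0` and both sides hold
    -- trivially.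
    rcases Nat.eq_zero_or_pos n with rfl | hn
    · simp [fdes_of_eq_zero]
    have h0 := minWord_zero w hn
    have hmin : ∀ i, minWord w i + 2 * l i ≤ minWord w ⟨0, hn⟩ + 2 * l ⟨0, hn⟩ := by
      intro i
      have hc : Compatible w fun i => minWord w i + 2 * l i := (compatible_iff hw).2 ⟨l, hl, rfl⟩
      rcases (Fin.le_def.2 (Nat.zero_le i) : (⟨0, hn⟩ : Fin n) ≤ i).eq_or_lt with h | h
      · rw [h]
      · have := hc.lt_or_eq hw h
        omega
    constructor
    · intro h
      have := h ⟨0, hn⟩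
      refine ⟨by omega, fun i => ?_⟩
      have : l i ≤ l ⟨0, hn⟩ := hl (Fin.le_def.2 (Nat.zero_le i))
      omega
    · rintro ⟨h, h'⟩ i
      have := hmin i
      have := h' ⟨0, hn⟩
      omega
  have hmem : ∀ l : Fin n → ℕ, Antitone l →
      ((fun i => minWord w i + 2 * l i) ∈ words (range (s + 1)) n ↔
        fdes w ≤ s ∧ ∀ i, l i ≤ (s - fdes w) / 2) := fun l hl => by
    rw [← hbound l hl]
    simp only [words, Fintype.mem_piFinset, mem_range]
  split_ifs with hs
  · rw [partSum, mul_sum]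
    symm
    refine sum_bij (fun l _ i => minWord w i + 2 * l i) ?_ ?_ ?_ ?_
    · intro l hl
      obtain ⟨h₁, h₂⟩ := mem_parts.1 hl
      exact mem_filter.2 ⟨(hmem l h₂).2 ⟨hs, h₁⟩, (compatible_iff hw).2 ⟨l, h₂, rfl⟩⟩
    · intro l _ l' _ h
      funext i
      have := congrFun h i
      omega
    · intro b hb
      obtain ⟨hb, hc⟩ := mem_filter.1 hb
      obtain ⟨l, hl, rfl⟩ := (compatible_iff hw).1 hc
      exact ⟨l, mem_parts.2 ⟨((hmem l hl).1 hb).2, hl⟩, rfl⟩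
    · intro l _
      rw [sum_add_distrib, sum_minWord, ← mul_sum, pow_add, pow_mul]
  · refine sum_eq_zero fun b hb => ?_
    obtain ⟨hb, hc⟩ := mem_filter.1 hb
    obtain ⟨l, hl, rfl⟩ := (compatible_iff hw).1 hc
    exact absurd ((hmem l hl).1 hb).1 hs

theorem wordSum_eq (n s : ℕ) : wordSum (range (s + 1)) letterX letterY n =
    ∑ w ∈ signedPerms n, signWeight w * if fdes w ≤ s then
      sX .q ^ fmaj w * partSum (sX .q ^ 2) n ((s - fdes w) / 2) else 0 := by
  rw [wordSum_eq_sum_signedPerms]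
  exact sum_congr rfl fun w hw => by
    rw [sum_compatible (injective_of_mem_signedPerms hw)]

end Compatible

/-! ### Partitions in a box -/

section Partitions

lemma partSum_zero_left (p : Series) (m : ℕ) : partSum p 0 m = 1 := by
  have : parts 0 m = {Fin.elim0} := by
    ext l
    simp [mem_parts, Subsingleton.elim l Fin.elim0, Antitone]
  simp [partSum, this]

lemma partSum_zero_right (p : Series) (n : ℕ) : partSum p n 0 = 1 := by
  have : parts n 0 = {fun _ => 0} := by
    ext l
    simp only [mem_parts, Nat.le_zero, mem_singleton]
    refine ⟨fun h => funext h.1, ?_⟩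
    rintro rfl
    exact ⟨fun _ => rfl, antitone_const⟩
  simp [partSum, this]

/-- Either the last, smallest part is `0` and is dropped, or `1` is subtracted from all `n + 1`
parts. -/
lemma partSum_succ_succ (p : Series) (n m : ℕ) :
    partSum p (n + 1) (m + 1) = partSum p n (m + 1) + p ^ (n + 1) * partSum p (n + 1) m := by
  rw [partSum, ← sum_filter_add_sum_filter_not _ (fun l => l (Fin.last n) = 0)]
  congr 1
  · symm
    refine sum_bij (fun l _ => Fin.snoc (α := fun _ => ℕ) l 0) ?_ ?_ ?_ ?_
    · intro l hl
      obtain ⟨h₁, h₂⟩ := mem_parts.1 hl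
      refine mem_filter.2 ⟨mem_parts.2 ⟨fun i => ?_, fun i j hij => ?_⟩, by simp⟩
      · induction i using Fin.lastCases <;> simp [h₁]
      · induction j using Fin.lastCases with
        | last => simp
        | cast j =>
          induction i using Fin.lastCases with
          | last => exact absurd hij (by simp [Fin.le_def])
          | cast i => simpa using h₂ (by simpa using hij)
    · intro l _ l' _ h
      exact (Fin.snoc_injective2 h).1
    · intro d hd
      obtain ⟨hd, h0⟩ := mem_filter.1 hd
      obtain ⟨h₁, h₂⟩ := mem_parts.1 hd
      refine ⟨Fin.init d, mem_parts.2 ⟨fun i => h₁ _, fun i j hij => h₂ (by simpa using hij)⟩, ?_⟩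
      rw [← h0, Fin.snoc_init_self]
    · intro l _
      rw [Fin.sum_univ_castSucc]
      simp
  · rw [partSum, mul_sum]
    symm
    refine sum_bij (fun l _ i => l i + 1) ?_ ?_ ?_ ?_
    · intro l hl
      obtain ⟨h₁, h₂⟩ := mem_parts.1 hl
      exact mem_filter.2 ⟨mem_parts.2 ⟨fun i => Nat.succ_le_succ (h₁ i),
        fun i j hij => Nat.succ_le_succ (h₂ hij)⟩, by simp⟩
    · intro l _ l' _ h
      funext i
      simpa using congrFun h i
    · intro d hd
      obtain ⟨hd, h0⟩ := mem_filter.1 hd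
      obtain ⟨h₁, h₂⟩ := mem_parts.1 hd
      refine ⟨fun i => d i - 1, mem_parts.2 ⟨fun i => by have := h₁ i; omega,
        fun i j hij => Nat.sub_le_sub_right (h₂ hij) 1⟩, funext fun i => ?_⟩
      have : d (Fin.last n) ≤ d i := h₂ (Fin.le_last i)
      simp only
      omega
    · intro l _
      rw [sum_add_distrib, pow_add, mul_comm]
      simp [pow_add]

/-- The product formula for Gaussian binomial coefficients. -/
lemma partSum_mul_poch (p : Series) (n m : ℕ) :
    partSum p n m * poch p p n = poch (p ^ (m + 1)) p n := by
  induction n generalizing m with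
  | zero => simp [partSum_zero_left, poch]
  | succ n ihn =>
    induction m with
    | zero => simp [partSum_zero_right]
    | succ m ihm =>
      have h₁ := ihn (m + 1)
      have h₂ : poch (p ^ (m + 1)) p (n + 1) = (1 - p ^ (m + 1)) * poch (p ^ (m + 1 + 1)) p n := by
        rw [poch, prod_range_succ', poch, mul_comm]
        simp only [pow_zero, mul_one]
        congr 1
        exact prod_congr rfl fun i _ => by ring
      have h₃ : ∀ a, poch a p (n + 1) = poch a p n * (1 - a * p ^ n) := fun a => by
        rw [poch, prod_range_succ, poch]
      rw [partSum_succ_succ]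
      rw [h₂] at ihm
      rw [h₃ (p ^ (m + 1 + 1))]
      have h₄ := h₃ p
      linear_combination p ^ (n + 1) * ihm + (1 - p * p ^ n) * h₁ + partSum p n (m + 1) * h₄

end Partitions

/-! ### The generating series in `t` -/

section TSeries

lemma inv_mul_of_constantCoeff_eq_one {f : Series} (h : MvPowerSeries.constantCoeff f = 1) :
    f⁻¹ * f = 1 :=
  MvPowerSeries.inv_mul_cancel f (by simp [h])

lemma eq_inv_of_mul_eq_one {f g : Series} (h : MvPowerSeries.constantCoeff g = 1)
    (hfg : f * g = 1) : f = g⁻¹ :=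
  (MvPowerSeries.eq_inv_iff_mul_eq_one (by simp [h])).2 hfg

lemma hasSum_congr_eq {f g : ℕ → Series} {a b : Series} (h : HasSum f a) (hf : ∀ s, g s = f s)
    (hb : b = a) : HasSum g b := by
  rw [hb, funext hf]
  exact h

lemma summable_t_sq (f : ℕ → Series) : Summable fun m => sX .t ^ (2 * m) * f m := by
  simpa only [two_mul, pow_add, mul_assoc] using
    summable_X_pow_mul .t fun m => sX .t ^ m * f m

lemma tsum_partSum_zero :
    (∑' m, sX .t ^ (2 * m) * partSum (sX .q ^ 2) 0 m) * (1 - sX .t ^ 2) = 1 := by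
  have h := (summable_t_sq fun m => partSum (sX .q ^ 2) 0 m).tsum_eq_zero_add
  have h' : ∑' m, sX .t ^ (2 * (m + 1)) * partSum (sX .q ^ 2) 0 (m + 1) =
      sX .t ^ 2 * ∑' m, sX .t ^ (2 * m) * partSum (sX .q ^ 2) 0 m := by
    rw [← (summable_t_sq _).tsum_mul_left]
    exact tsum_congr fun m => by simp only [partSum_zero_left]; ring
  rw [h', partSum_zero_left] at h
  linear_combination h

lemma tsum_partSum_succ (n : ℕ) :
    (∑' m, sX .t ^ (2 * m) * partSum (sX .q ^ 2) (n + 1) m) *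
      (1 - sX .t ^ 2 * (sX .q ^ 2) ^ (n + 1)) =
      ∑' m, sX .t ^ (2 * m) * partSum (sX .q ^ 2) n m := by
  have h := (summable_t_sq fun m => partSum (sX .q ^ 2) (n + 1) m).tsum_eq_zero_add
  have h₀ := (summable_t_sq fun m => partSum (sX .q ^ 2) n m).tsum_eq_zero_add
  have hs : Summable fun m => sX .t ^ (2 * (m + 1)) * partSum (sX .q ^ 2) n (m + 1) :=
    (summable_nat_add_iff (f := fun m => sX .t ^ (2 * m) * partSum (sX .q ^ 2) n m) 1).2
      (summable_t_sq fun m => partSum (sX .q ^ 2) n m)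
  have h' : ∑' m, sX .t ^ (2 * (m + 1)) * partSum (sX .q ^ 2) (n + 1) (m + 1) =
      ∑' m, sX .t ^ (2 * (m + 1)) * partSum (sX .q ^ 2) n (m + 1) +
      sX .t ^ 2 * (sX .q ^ 2) ^ (n + 1) *
        ∑' m, sX .t ^ (2 * m) * partSum (sX .q ^ 2) (n + 1) m := by
    rw [← (summable_t_sq _).tsum_mul_left, ← hs.tsum_add ((summable_t_sq _).mul_left _)]
    exact tsum_congr fun m => by rw [partSum_succ_succ]; ring
  rw [h', partSum_zero_right] at h
  rw [partSum_zero_right] at h₀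
  linear_combination h - h₀

lemma hasSum_partSum (n : ℕ) : HasSum (fun m => sX .t ^ (2 * m) * partSum (sX .q ^ 2) n m)
    (poch (sX .t ^ 2) (sX .q ^ 2) (n + 1))⁻¹ := by
  rw [← eq_inv_of_mul_eq_one (f := ∑' m, sX .t ^ (2 * m) * partSum (sX .q ^ 2) n m)
    (constantCoeff_poch (by simp) _ _)]
  · exact (summable_t_sq _).hasSum
  · induction n with
    | zero => simpa [poch] using tsum_partSum_zero
    | succ n ih =>
      rw [poch, prod_range_succ, ← poch]
      linear_combination ih + poch (sX .t ^ 2) (sX .q ^ 2) (n + 1) * tsum_partSum_succ n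

/-- The values `s = f + 2m` and `s = f + 2m + 1` give the same box height `m`; this is the origin of
the factor `1 + t`. -/
lemma hasSum_partSum_half (n f : ℕ) :
    HasSum (fun s => sX .t ^ s * if f ≤ s then partSum (sX .q ^ 2) n ((s - f) / 2) else 0)
      (sX .t ^ f * ((1 + sX .t) * (poch (sX .t ^ 2) (sX .q ^ 2) (n + 1))⁻¹)) := by
  have h := hasSum_partSum n
  have heo : HasSum (fun s => sX .t ^ s * partSum (sX .q ^ 2) n (s / 2))
      ((1 + sX .t) * (poch (sX .t ^ 2) (sX .q ^ 2) (n + 1))⁻¹) := by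
    rw [add_mul, one_mul]
    refine HasSum.even_add_odd ?_ ?_
    · simpa using h
    · refine hasSum_congr_eq (h.mul_left (sX .t)) (fun m => ?_) rfl
      rw [show (2 * m + 1) / 2 = m by omega]
      ring
  rw [← (add_left_injective f).hasSum_iff]
  · refine hasSum_congr_eq (heo.mul_left (sX .t ^ f)) (fun s => ?_) rfl
    simp only [Function.comp_apply, Nat.le_add_left, if_true, Nat.add_sub_cancel]
    ring
  · intro s hs
    rw [if_neg, mul_zero]
    exact fun hfs => hs ⟨s - f, Nat.sub_add_cancel hfs⟩

end TSeries

/-! ### The polynomials -/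

section Polynomials

/-- The generating polynomial of `B_n` by all five statistics. -/
noncomputable def gradedPoly (n : ℕ) : Poly := ∑ w ∈ signedPerms n,
  pX .t ^ fdes w * pX .q ^ fmaj w * pX .Y₀ ^ fixPos w * pX .Y₁ ^ fixNeg w * pX .Z ^ neg w

/-- The generating polynomial of `B_n` by `fmaj`, fixed points and signs. -/
noncomputable def fmajPoly (n : ℕ) : Poly := ∑ w ∈ signedPerms n,
  pX .q ^ fmaj w * pX .Y₀ ^ fixPos w * pX .Y₁ ^ fixNeg w * pX .Z ^ neg w

lemma setTOne_gradedPoly (n : ℕ) : setTOne (gradedPoly n) = fmajPoly n := by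
  simp [gradedPoly, fmajPoly, setTOne]

lemma coe_gradedPoly (n : ℕ) : (gradedPoly n : Series) =
    ∑ w ∈ signedPerms n, signWeight w * (sX .q ^ fmaj w * sX .t ^ fdes w) := by
  rw [gradedPoly, ← MvPolynomial.coeToMvPowerSeries.ringHom_apply, map_sum]
  refine sum_congr rfl fun w _ => ?_
  simp only [map_mul, map_pow, MvPolynomial.coeToMvPowerSeries.ringHom_apply,
    MvPolynomial.coe_X, signWeight]
  ring

lemma coe_fmajPoly (n : ℕ) : (fmajPoly n : Series) =
    ∑ w ∈ signedPerms n, signWeight w * sX .q ^ fmaj w := by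
  rw [fmajPoly, ← MvPolynomial.coeToMvPowerSeries.ringHom_apply, map_sum]
  refine sum_congr rfl fun w _ => ?_
  simp only [map_mul, map_pow, MvPolynomial.coeToMvPowerSeries.ringHom_apply,
    MvPolynomial.coe_X, signWeight]
  ring

lemma pX_pow_mem_supported {S : Set Var} {v : Var} (hv : v ∈ S) (k : ℕ) :
    pX v ^ k ∈ MvPolynomial.supported ℚ S :=
  pow_mem (Algebra.subset_adjoin (Set.mem_image_of_mem _ hv)) k

lemma gradedPoly_mem_supported (n : ℕ) :
    gradedPoly n ∈ MvPolynomial.supported ℚ {Var.t, Var.q, Var.Y₀, Var.Y₁, Var.Z} :=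
  sum_mem fun w _ => mul_mem (mul_mem (mul_mem (mul_mem (pX_pow_mem_supported (by simp) _)
    (pX_pow_mem_supported (by simp) _)) (pX_pow_mem_supported (by simp) _))
    (pX_pow_mem_supported (by simp) _)) (pX_pow_mem_supported (by simp) _)

lemma fmajPoly_mem_supported (n : ℕ) :
    fmajPoly n ∈ MvPolynomial.supported ℚ {Var.q, Var.Y₀, Var.Y₁, Var.Z} :=
  sum_mem fun w _ => mul_mem (mul_mem (mul_mem (pX_pow_mem_supported (by simp) _)
    (pX_pow_mem_supported (by simp) _)) (pX_pow_mem_supported (by simp) _))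
    (pX_pow_mem_supported (by simp) _)

/-- The words of length `n` over `0, …, s`, summed over `s`. -/
lemma hasSum_wordSum (n : ℕ) :
    HasSum (fun s => sX .t ^ s * wordSum (range (s + 1)) letterX letterY n)
      ((1 + sX .t) * (gradedPoly n : Series) * (poch (sX .t ^ 2) (sX .q ^ 2) (n + 1))⁻¹) := by
  have h := hasSum_sum (s := signedPerms n) fun w _ =>
    (hasSum_partSum_half n (fdes w)).mul_left (signWeight w * sX .q ^ fmaj w)
  refine hasSum_congr_eq h (fun s => ?_) ?_
  · rw [wordSum_eq, mul_sum]
    refine sum_congr rfl fun w _ => ?_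
    split_ifs <;> ring
  · rw [coe_gradedPoly, mul_sum, sum_mul]
    exact sum_congr rfl fun w _ => by ring

/-- The double family `u^n t^s · wordSum` is summed in both orders. It is summable because a given
monomial bounds both `n` and `s`. -/
theorem isGradedSeq_gradedPoly : IsGradedSeq gradedPoly := by
  refine ⟨gradedPoly_mem_supported, ?_⟩
  set a : ℕ × ℕ → Series := fun p =>
    sX .u ^ p.1 * (sX .t ^ p.2 * wordSum (range (p.2 + 1)) letterX letterY p.1) with ha
  have hs : Summable a := by
    rw [MvPowerSeries.WithPiTopology.summable_iff_summable_coeff]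
    refine fun m => summable_of_ne_finset_zero (s := range (m .u + 1) ×ˢ range (m .t + 1))
      fun p hp => ?_
    rw [mem_product, not_and_or, mem_range, mem_range] at hp
    rcases hp with hp | hp
    · exact coeff_X_pow_mul_eq_zero (by omega) _
    · rw [ha]
      simp only
      rw [mul_left_comm]
      exact coeff_X_pow_mul_eq_zero (by omega) _
  refine ⟨∑' p, a p, hs.hasSum.prod_fiberwise fun n => ?_,
    ((Equiv.prodComm ℕ ℕ).hasSum_iff.2 hs.hasSum).prod_fiberwise fun s => ?_⟩
  · exact hasSum_congr_eq ((hasSum_wordSum n).mul_left (sX .u ^ n)) (fun _ => rfl) (by ring)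
  · rw [← uSeries_wordSum_eq_gradedTerm]
    have h := (summable_X_pow_mul .u
      fun n => wordSum (range (s + 1)) letterX letterY n).hasSum.mul_left (sX .t ^ s)
    refine hasSum_congr_eq h (fun n => ?_) rfl
    simp only [ha, Function.comp_apply, Equiv.prodComm_apply, Prod.swap]
    ring

end Polynomials

/-! ### Uniqueness -/

section Uniqueness

/-- The subring of series that do not involve `u`. -/
noncomputable def uFree : Subring Series where
  carrier := {f | ∀ m : Var →₀ ℕ, m .u ≠ 0 → MvPowerSeries.coeff m f = 0}
  zero_mem' := fun m _ => by simp
  one_mem' := fun m hm => by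
    classical
    rw [MvPowerSeries.coeff_one, if_neg]
    rintro rfl
    exact hm rfl
  add_mem' := fun hf hg m hm => by simp [hf m hm, hg m hm]
  neg_mem' := fun hf m hm => by simp [hf m hm]
  mul_mem' := fun {f g} hf hg m hm => by
    classical
    rw [MvPowerSeries.coeff_mul]
    refine sum_eq_zero fun p hp => ?_
    have hp : p.1 .u + p.2 .u = m .u := by rw [← mem_antidiagonal.1 hp]; rfl
    by_cases h : p.1 .u = 0
    · rw [hg p.2 (by omega), mul_zero]
    · rw [hf p.1 h, zero_mul]

/-- Induction along the recursion for the coefficients of an inverse: in each product one of the two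
exponents involves `u`. -/
lemma inv_mem_uFree {f : Series} (hf : f ∈ uFree) : f⁻¹ ∈ uFree := by
  classical
  intro m
  induction m using WellFoundedLT.induction with
  | ind m ih =>
    intro hm
    rw [MvPowerSeries.coeff_inv, if_neg (by rintro rfl; exact hm rfl)]
    rw [sum_eq_zero, mul_zero]
    intro p hp
    have hpu : p.1 .u + p.2 .u = m .u := by rw [← mem_antidiagonal.1 hp]; rfl
    split_ifs with hlt
    · by_cases h : p.1 .u = 0
      · rw [ih p.2 hlt (by omega), mul_zero]
      · rw [hf p.1 h, zero_mul]
    · rfl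

lemma sX_mem_uFree {v : Var} (hv : v ≠ .u) : sX v ∈ uFree := by
  classical
  intro m hm
  rw [MvPowerSeries.coeff_X, if_neg]
  rintro rfl
  exact hm (by simp [hv])

lemma poch_mem_uFree {a p : Series} (ha : a ∈ uFree) (hp : p ∈ uFree) (n : ℕ) :
    poch a p n ∈ uFree :=
  prod_mem fun i _ => sub_mem (one_mem _) (mul_mem ha (pow_mem hp i))

lemma coe_mem_uFree {S : Set Var} (hS : Var.u ∉ S) {f : Poly}
    (hf : f ∈ MvPolynomial.supported ℚ S) : (f : Series) ∈ uFree := by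
  intro m hm
  rw [MvPolynomial.coeff_coe]
  by_contra h
  refine hS (MvPolynomial.mem_supported.1 hf ?_)
  exact (MvPolynomial.mem_vars_iff_mem_support _).2 ⟨m, MvPolynomial.mem_support_iff.2 h, by simpa using hm⟩

lemma coeff_X_pow_mul_u (m : Var →₀ ℕ) (k : ℕ) (f : Series) :
    MvPowerSeries.coeff m (sX .u ^ k * f) = if k ≤ m .u then
      MvPowerSeries.coeff (m - Finsupp.single .u k) f else 0 := by
  classical
  rw [MvPowerSeries.X_pow_eq, MvPowerSeries.coeff_monomial_mul]
  simp

lemma coeff_eq_of_hasSum {f : ℕ → Series} (hf : ∀ n, f n ∈ uFree) {F : Series}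
    (h : HasSum (fun n => sX .u ^ n * f n) F) (m : Var →₀ ℕ) :
    MvPowerSeries.coeff m F =
      MvPowerSeries.coeff (m - Finsupp.single .u (m .u)) (f (m .u)) := by
  refine (MvPowerSeries.WithPiTopology.hasSum_iff_hasSum_coeff.1 h m).unique ?_
  convert hasSum_single (m .u) fun k hk => ?_ using 1
  · rw [coeff_X_pow_mul_u, if_pos le_rfl]
  · rw [coeff_X_pow_mul_u]
    split_ifs with hle
    · exact hf k _ (by simp; omega)
    · rfl

/-- A series is determined by its coefficients with respect to `u`. -/
lemma eq_of_hasSum {f g : ℕ → Series} (hf : ∀ n, f n ∈ uFree) (hg : ∀ n, g n ∈ uFree)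
    {F : Series} (hfF : HasSum (fun n => sX .u ^ n * f n) F)
    (hgF : HasSum (fun n => sX .u ^ n * g n) F) (n : ℕ) : f n = g n := by
  ext m
  by_cases hm : m .u = 0
  · have h₁ := coeff_eq_of_hasSum hf hfF (m + Finsupp.single .u n)
    have h₂ := coeff_eq_of_hasSum hg hgF (m + Finsupp.single .u n)
    simp only [Finsupp.add_apply, Finsupp.single_eq_same, hm, zero_add,
      add_tsub_cancel_right] at h₁ h₂
    rw [← h₁, ← h₂]
  · rw [hf n m hm, hg n m hm]

lemma IsGradedSeq.unique {B B' : ℕ → Poly} (h : IsGradedSeq B) (h' : IsGradedSeq B') :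
    B = B' := by
  obtain ⟨hB, F, hBF, hF⟩ := h
  obtain ⟨hB', F', hBF', hF'⟩ := h'
  obtain rfl := hF.unique hF'
  have hfree : ∀ C : ℕ → Poly,
      (∀ n, C n ∈ MvPolynomial.supported ℚ {Var.t, Var.q, Var.Y₀, Var.Y₁, Var.Z}) → ∀ n,
      (1 + sX .t) * (C n : Series) * (poch (sX .t ^ 2) (sX .q ^ 2) (n + 1))⁻¹ ∈ uFree :=
    fun C hC n => mul_mem (mul_mem (add_mem (one_mem _) (sX_mem_uFree (by simp)))
      (coe_mem_uFree (by simp) (hC n))) (inv_mem_uFree (poch_mem_uFree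
      (pow_mem (sX_mem_uFree (by simp)) 2) (pow_mem (sX_mem_uFree (by simp)) 2) _))
  funext n
  have hn := eq_of_hasSum (hfree B hB) (hfree B' hB') (F := F)
    (by convert hBF using 2; ring) (by convert hBF' using 2; ring) n
  have e₁ := inv_mul_of_constantCoeff_eq_one
    (constantCoeff_poch (a := sX .t ^ 2) (by simp) (sX .q ^ 2) (n + 1))
  have e₂ := inv_mul_of_constantCoeff_eq_one (f := 1 + sX .t) (by simp)
  apply MvPolynomial.coe_injective
  set P := poch (sX .t ^ 2) (sX .q ^ 2) (n + 1)
  set T : Series := 1 + sX .t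
  linear_combination T⁻¹ * P * hn - (P⁻¹ * P * ((B n : Series) - B' n)) * e₂ -
    ((B n : Series) - B' n) * e₁

lemma IsFmajSeq.unique {C C' : ℕ → Poly} (h : IsFmajSeq C) (h' : IsFmajSeq C') : C = C' := by
  obtain ⟨hC, hCF⟩ := h
  obtain ⟨hC', hCF'⟩ := h'
  have hfree : ∀ C : ℕ → Poly,
      (∀ n, C n ∈ MvPolynomial.supported ℚ {Var.q, Var.Y₀, Var.Y₁, Var.Z}) → ∀ n,
      (poch (sX .q ^ 2) (sX .q ^ 2) n)⁻¹ * (C n : Series) ∈ uFree :=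
    fun C hC n => mul_mem (inv_mem_uFree (poch_mem_uFree
      (pow_mem (sX_mem_uFree (by simp)) 2) (pow_mem (sX_mem_uFree (by simp)) 2) _))
      (coe_mem_uFree (by simp) (hC n))
  funext n
  have hn := eq_of_hasSum (hfree C hC) (hfree C' hC')
    (by simpa only [mul_assoc] using hCF) (by simpa only [mul_assoc] using hCF') n
  have e₁ := inv_mul_of_constantCoeff_eq_one
    (constantCoeff_poch (a := sX .q ^ 2) (by simp) (sX .q ^ 2) n)
  apply MvPolynomial.coe_injective
  linear_combination poch (sX .q ^ 2) (sX .q ^ 2) n * hn - ((C n : Series) - C' n) * e₁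

end Uniqueness

/-! ### The limit over all words -/

section Limit

/-- A fixed coefficient of the series depends only on the finitely many terms with `n` at most the
exponent of `u`. -/
lemma tendsto_uSeries {f : ℕ → ℕ → Series} {g : ℕ → Series}
    (h : ∀ n, Tendsto (fun s => f s n) atTop (𝓝 (g n))) :
    Tendsto (fun s => uSeries (f s)) atTop (𝓝 (uSeries g)) := by
  rw [MvPowerSeries.WithPiTopology.tendsto_iff_coeff_tendsto]
  intro m
  have hc : ∀ k : ℕ → Series, MvPowerSeries.coeff m (uSeries k) =
      ∑ n ∈ range (m .u + 1), MvPowerSeries.coeff m (sX .u ^ n * k n) := fun k =>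
    (MvPowerSeries.WithPiTopology.hasSum_iff_hasSum_coeff.1
      (summable_X_pow_mul .u k).hasSum m).unique
      (hasSum_sum_of_ne_finset_zero fun n hn => coeff_X_pow_mul_eq_zero (by simpa using hn) _)
  simp only [hc]
  exact tendsto_finsetSum _ fun n _ =>
    ((MvPowerSeries.WithPiTopology.continuous_coeff ℚ m).tendsto _).comp
      ((h n).const_mul (sX .u ^ n))

lemma tendsto_pow_zero {p : Series} (hp : MvPowerSeries.constantCoeff p = 0) :
    Tendsto (fun k => p ^ k) atTop (𝓝 0) :=
  MvPowerSeries.WithPiTopology.isTopologicallyNilpotent_of_constantCoeff_zero hp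

lemma tendsto_partSum {p : Series} (hp : MvPowerSeries.constantCoeff p = 0) (n : ℕ) :
    Tendsto (partSum p n) atTop (𝓝 (poch p p n)⁻¹) := by
  have e := inv_mul_of_constantCoeff_eq_one (constantCoeff_poch hp p n)
  have h : partSum p n = fun m => poch (p ^ (m + 1)) p n * (poch p p n)⁻¹ := by
    funext m
    linear_combination (poch p p n)⁻¹ * partSum_mul_poch p n m - partSum p n m * e
  have h1 : Tendsto (fun m => poch (p ^ (m + 1)) p n) atTop (𝓝 1) := by
    have := tendsto_finsetProd (range n) fun i _ =>
      (((tendsto_pow_zero hp).comp (tendsto_add_atTop_nat 1)).mul_const (p ^ i)).const_sub 1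
    simpa [poch] using this
  rw [h]
  simpa using h1.mul_const _

/-- As `s` grows, the condition `fdes w ≤ s` becomes vacuous and the bound on the parts disappears,
which leaves `q^fmaj / (q²; q²)_n` for each `w`. -/
lemma tendsto_wordSum (n : ℕ) :
    Tendsto (fun s => wordSum (range (s + 1)) letterX letterY n) atTop
      (𝓝 ((poch (sX .q ^ 2) (sX .q ^ 2) n)⁻¹ * (fmajPoly n : Series))) := by
  rw [coe_fmajPoly, mul_sum]
  simp only [wordSum_eq]
  refine tendsto_finsetSum _ fun w _ => ?_
  have h := (tendsto_partSum (p := sX .q ^ 2) (by simp) n).comp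
    ((Nat.tendsto_div_const_atTop two_ne_zero).comp (tendsto_sub_atTop_nat (fdes w)))
  have h' := h.const_mul (signWeight w * sX .q ^ fmaj w)
  rw [mul_comm (poch _ _ _)⁻¹]
  refine h'.congr' ?_
  filter_upwards [eventually_ge_atTop (fdes w)] with s hs
  rw [if_pos hs]
  simp [mul_assoc]

lemma multipliable_poch {a p : Series} (hp : MvPowerSeries.constantCoeff p = 0) :
    Multipliable fun i : ℕ => 1 - a * p ^ i := by
  have : Multipliable fun i : ℕ => 1 + -(a * p ^ i) := by
    refine MvPowerSeries.WithPiTopology.multipliable_one_add_of_tendsto_order_atTop_nhds_top ?_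
    refine tendsto_of_tendsto_of_tendsto_of_le_of_le ENat.tendsto_natCast_nhds_top
      tendsto_const_nhds (fun i => ?_) fun i => le_top
    have h : (i : ℕ∞) ≤ (p ^ i).order :=
      MvPowerSeries.le_order_pow_of_constantCoeff_eq_zero i hp
    rw [← neg_mul]
    exact (h.trans le_add_self).trans MvPowerSeries.le_order_mul
  simpa only [sub_eq_add_neg] using this

lemma tendsto_poch {a p : Series} (hp : MvPowerSeries.constantCoeff p = 0) :
    Tendsto (poch a p) atTop (𝓝 (pochInf a p)) :=
  (multipliable_poch hp).hasProd.tendsto_prod_nat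

lemma constantCoeff_pochInf {a p : Series} (ha : MvPowerSeries.constantCoeff a = 0)
    (hp : MvPowerSeries.constantCoeff p = 0) :
    MvPowerSeries.constantCoeff (pochInf a p) = 1 := by
  have h := ((MvPowerSeries.WithPiTopology.continuous_constantCoeff ℚ).tendsto _).comp
    (tendsto_poch (a := a) hp)
  refine tendsto_nhds_unique h ?_
  simp [Function.comp_def, constantCoeff_poch ha]

/-- Since `letterX (a + 2) = q² letterX a`, the product telescopes to the first two letters minus
the two that follow the last. -/
lemma sum_letterX (s : ℕ) : (∑ a ∈ range (s + 1), letterX a) * (1 - sX .q ^ 2) =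
    1 + sX .q * sX .Z - (letterX (s + 1) + letterX (s + 2)) := by
  have h2 : ∀ a, letterX (a + 2) = sX .q ^ 2 * letterX a := fun a => by
    have h : Odd (a + 2) ↔ Odd a := by simp only [Nat.odd_iff]; omega
    simp only [letterX, h]
    ring
  induction s with
  | zero =>
    have h0 : letterX 0 = 1 := by simp [letterX]
    have h1 : letterX 1 = sX .q * sX .Z := by simp [letterX]
    simp only [zero_add, sum_range_one, h2 0, h0, h1]
    ring
  | succ s ih =>
    rw [sum_range_succ, add_mul, ih, h2 (s + 1)]
    ring

lemma tendsto_letterX : Tendsto letterX atTop (𝓝 0) := by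
  rw [MvPowerSeries.WithPiTopology.tendsto_iff_coeff_tendsto]
  intro m
  refine tendsto_const_nhds.congr' ?_
  filter_upwards [eventually_gt_atTop (m .q)] with a ha
  rw [letterX, coeff_X_pow_mul_eq_zero ha, map_zero]

lemma tendsto_sum_letterX : Tendsto (fun s => ∑ a ∈ range (s + 1), letterX a) atTop
    (𝓝 ((1 + sX .q * sX .Z) * (1 - sX .q ^ 2)⁻¹)) := by
  have e := inv_mul_of_constantCoeff_eq_one (f := 1 - sX .q ^ 2) (by simp)
  have h : (fun s => ∑ a ∈ range (s + 1), letterX a) = fun s =>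
      (1 + sX .q * sX .Z - (letterX (s + 1) + letterX (s + 2))) * (1 - sX .q ^ 2)⁻¹ := by
    funext s
    linear_combination (1 - sX .q ^ 2)⁻¹ * sum_letterX s - (∑ a ∈ range (s + 1), letterX a) * e
  rw [h]
  have := ((tendsto_letterX.comp (tendsto_add_atTop_nat 1)).add
    (tendsto_letterX.comp (tendsto_add_atTop_nat 2))).const_sub (1 + sX .q * sX .Z)
  simpa using this.mul_const (1 - sX .q ^ 2)⁻¹

theorem isFmajSeq_fmajPoly : IsFmajSeq fmajPoly := by
  refine ⟨fmajPoly_mem_supported, ?_⟩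
  set c : ℕ → Series := fun n => (poch (sX .q ^ 2) (sX .q ^ 2) n)⁻¹ * (fmajPoly n : Series)
  have hq : MvPowerSeries.constantCoeff (sX .q ^ 2) = 0 := by simp
  have h₁ : Tendsto (fun s => s / 2 + 1) atTop atTop :=
    (tendsto_add_atTop_nat 1).comp (Nat.tendsto_div_const_atTop two_ne_zero)
  have h₂ : Tendsto (fun s => (s + 1) / 2) atTop atTop :=
    (Nat.tendsto_div_const_atTop two_ne_zero).comp (tendsto_add_atTop_nat 1)
  have hl := (tendsto_uSeries tendsto_wordSum).mul
    (((tendsto_sum_letterX.const_mul (sX .u)).const_sub 1).mul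
      (((tendsto_poch (a := sX .u * sX .Y₀) hq).comp h₁).mul
        ((tendsto_poch (a := -(sX .u * sX .q * sX .Z)) hq).comp h₂)))
  have hr := ((tendsto_poch (a := sX .u) hq).comp h₁).mul
    ((tendsto_poch (a := -(sX .u * sX .q * sX .Y₁ * sX .Z)) hq).comp h₂)
  -- The limit is taken in the identity cleared of denominators, so continuity of inversion is not
  -- needed.
  have heq := tendsto_nhds_unique (hl.congr fun s => by
    have h := uSeries_wordSum (range (s + 1)) letterX letterY
    rw [prod_letterDen, prod_letterNum] at h
    exact h) hr
  have e₁ := inv_mul_of_constantCoeff_eq_one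
    (f := 1 - sX .u * ((1 + sX .q * sX .Z) * (1 - sX .q ^ 2)⁻¹)) (by simp)
  have e₂ := inv_mul_of_constantCoeff_eq_one
    (constantCoeff_pochInf (a := sX .u * sX .Y₀) (by simp) hq)
  have e₃ := inv_mul_of_constantCoeff_eq_one
    (constantCoeff_pochInf (a := -(sX .u * sX .q * sX .Z)) (by simp) hq)
  have hs : HasSum (fun n => sX .u ^ n * c n) (uSeries c) := (summable_X_pow_mul .u c).hasSum
  simp only [mul_assoc (sX .u ^ _)]
  convert hs using 1
  set A := 1 - sX .u * ((1 + sX .q * sX .Z) * (1 - sX .q ^ 2)⁻¹)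
  set P := pochInf (sX .u * sX .Y₀) (sX .q ^ 2)
  set Q := pochInf (-(sX .u * sX .q * sX .Z)) (sX .q ^ 2)
  calc _ = (pochInf (sX .u) (sX .q ^ 2) *
        pochInf (-(sX .u * sX .q * sX .Y₁ * sX .Z)) (sX .q ^ 2)) * (A⁻¹ * P⁻¹ * Q⁻¹) := by ring
    _ = uSeries c * ((A⁻¹ * A) * (P⁻¹ * P) * (Q⁻¹ * Q)) := by rw [← heq]; ring
    _ = uSeries c := by rw [e₁, e₂, e₃]; ring

end Limit

end SignedWords

/-! ### Assembly of the theorem -/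

open SignedWords
theorem theorem1p3 :
    (∃! B : ℕ → Poly, IsGradedSeq B) ∧
    (∃! C : ℕ → Poly, IsFmajSeq C) ∧
    ∀ B C : ℕ → Poly, IsGradedSeq B → IsFmajSeq C → ∀ n : ℕ,
      B n = ∑ w ∈ signedPerms n,
        pX .t ^ fdes w * pX .q ^ fmaj w * pX .Y₀ ^ fixPos w * pX .Y₁ ^ fixNeg w * pX .Z ^ neg w ∧
      setTOne (B n) = C n ∧
      C n = ∑ w ∈ signedPerms n,
        pX .q ^ fmaj w * pX .Y₀ ^ fixPos w * pX .Y₁ ^ fixNeg w * pX .Z ^ neg w := by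
  refine ⟨⟨gradedPoly, isGradedSeq_gradedPoly, fun _ h => h.unique isGradedSeq_gradedPoly⟩,
    ⟨fmajPoly, isFmajSeq_fmajPoly, fun _ h => h.unique isFmajSeq_fmajPoly⟩, ?_⟩
  intro B C hB hC n
  -- By uniqueness `B` and `C` are the two sums over signed permutations, and the substitution `t =
  -- 1` turns one into the other term by term.
  obtain rfl := hB.unique isGradedSeq_gradedPoly
  obtain rfl := hC.unique isFmajSeq_fmajPoly
  exact ⟨rfl, setTOne_gradedPoly n, rfl⟩
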